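/- **Notation.** For $n\ge 1$ and integer matrices $A,B\in\mathbb Z^{n\times n}$, $(A,B)$ is the two-player game in which player 1 picks a row and player 2 a column, with payoffs given by $A$ and $B$, and $\mathrm{NE}(A,B)$ is its set of mixed Nash equilibria. For a distribution $x$ on $\{1,\dots,n\}$ let $C(x)=q$ if $x=(p_1/q,\dots,p_n/q)$ with $p_i,q\in\mathbb N$, $q>0$, $\gcd(p_1,\dots,p_n)=1$, and $C(x)=\infty$ if $x$ is not rational. Put $C_1(A,B)=\min_{(x,y)\in \mathrm{NE}(A,B)}C(x)$ and $C_2(A,B)=\min_{(x,y)\in \mathrm{NE}(A,B)}C(y)$. Let $\mathbf 1_{n\times n}$ be the all-ones matrix, $I_n$ the identity matrix, and $K(A)$ the sum of all cofactors of $A$. Let $B_n\in\{0,1\}^{n\times n}$ have ones exactly on the main diagonal, on the first diagonal above it and on the second diagonal below it, and let $$\beta_n=\begin{pmatrix}\mathbf 0_{(n-1)\times 1}&B_{n-1}\\ 1&\mathbf 0_{1\times(n-1)}\end{pmatrix}\in\{0,1\}^{n\times n}.$$ Let $b_1=0,\ b_2=1,\ b_3=0,\ b_4=1$ and $b_n=b_{n-2}-b_{n-3}+b_{n-4}$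 for $n\ge5$. **Theorem.** There is a function $g(n)=\Theta(n)$ such that: 1. for every $n\ge1$ there are $A,B\in\{0,1\}^{n\times n}$ with $C_1(A,B)=2^{g(n)}$ and $C_2(A,B)=n$; 2. for every $n\ge1$ there are $A,B\in\{0,1\}^{n\times n}$ with $A+B=\mathbf 1_{n\times n}$ (so the game is constant-sum) and $C_1(A,B)=C_2(A,B)=2^{g(n)}$; 3. for every $n\ge1$ with $n\notin\{3,6,7\}$, the games in 1 and 2 can be taken to be $(I_n,\beta_n)$ and $(\mathbf 1_{n\times n}-\beta_n,\beta_n)$. That is, $C_1(I_n,\beta_n)=2^{g(n)}$, $C_2(I_n,\beta_n)=n$ and $C_1(\mathbf 1_{n\times n}-\beta_n,\beta_n)=C_2(\mathbf 1_{n\times n}-\beta_n,\beta_n)=2^{g(n)}$. Moreover $(I_n,\beta_n)$ has exactly one Nash equilibrium $(x,y)$, all coordinates of $x$ and $y$ are positive, $C(y)=n$, and $\gcd(b_n,b_{n+1})$ is positive and divides $|K(\beta_n)|$, with $$C(x)=\frac{|K(\beta_n)|}{\gcd(b_n,b_{n+1})}.$$ -/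

import Mathlib

open scoped ENNReal Matrix
open Filter Asymptotics

namespace RandomGames

noncomputable section

/-- The complexity of a vector `x = (p₁/q, …, pₙ/q)` with `p₁, …, pₙ, q ∈ ℕ`, `q > 0` and
`gcd (p₁, …, pₙ) = 1`: it is the (unique) denominator `q`. It is `⊤` if `x` has no such
representation, since the infimum of the empty set in `ℕ∞` is `⊤`. -/
def complexity {n : ℕ} (x : Fin n → ℝ) : ℕ∞ :=
  sInf {c : ℕ∞ | ∃ (p : Fin n → ℕ) (q : ℕ), c = (q : ℕ∞) ∧ 0 < q ∧
    Finset.univ.gcd p = 1 ∧ ∀ i, x i = (p i : ℝ) / (q : ℝ)}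

/-- The denominator in the definition of the complexity does not depend on the representation. -/
theorem complexity_eq {n : ℕ} {x : Fin n → ℝ} {p : Fin n → ℕ} {q : ℕ} (hq : 0 < q)
    (hp : Finset.univ.gcd p = 1) (hx : ∀ i, x i = (p i : ℝ) / (q : ℝ)) :
    complexity x = (q : ℕ∞) := by
  have key : {c : ℕ∞ | ∃ (p : Fin n → ℕ) (q : ℕ), c = (q : ℕ∞) ∧ 0 < q ∧
      Finset.univ.gcd p = 1 ∧ ∀ i, x i = (p i : ℝ) / (q : ℝ)} = {(q : ℕ∞)} := by
    ext c
    simp only [Set.mem_ofPred_eq, Set.mem_singleton_iff]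
    constructor
    · rintro ⟨p', q', rfl, hq', hp', hx'⟩
      have h : ∀ i, q' * p i = q * p' i := by
        intro i
        have e := (hx i).symm.trans (hx' i)
        have h1 : (q : ℝ) ≠ 0 := by positivity
        have h2 : (q' : ℝ) ≠ 0 := by positivity
        rw [div_eq_div_iff h1 h2] at e
        have e' : p i * q' = p' i * q := by exact_mod_cast e
        linarith
      have h3 : Finset.univ.gcd (fun i => q' * p i) = Finset.univ.gcd (fun i => q * p' i) := by
        simp only [h]
      rw [Finset.gcd_mul_left, Finset.gcd_mul_left, hp, hp'] at h3
      simp only [normalize_eq, mul_one] at h3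
      rw [h3]
    · rintro rfl
      exact ⟨p, q, rfl, hq, hp, hx⟩
  rw [complexity, key, sInf_singleton]

/-- The expected payoff `xᵀ A y` of the mixed profile `(x, y)`. -/
def payoff {n : ℕ} (A : Matrix (Fin n) (Fin n) ℤ) (x y : Fin n → ℝ) : ℝ :=
  x ⬝ᵥ (A.map (Int.cast : ℤ → ℝ) *ᵥ y)

/-- The set of (mixed) Nash equilibria of the game in which players 1 and 2 have payoff matrices
`A` and `B`; player 1 chooses the row and player 2 the column. -/
def nashEquilibria {n : ℕ} (A B : Matrix (Fin n) (Fin n) ℤ) :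
    Set ((Fin n → ℝ) × (Fin n → ℝ)) :=
  {p | p.1 ∈ stdSimplex ℝ (Fin n) ∧ p.2 ∈ stdSimplex ℝ (Fin n) ∧
    (∀ x ∈ stdSimplex ℝ (Fin n), payoff A x p.2 ≤ payoff A p.1 p.2) ∧
    (∀ y ∈ stdSimplex ℝ (Fin n), payoff B p.1 y ≤ payoff B p.1 p.2)}

/-- `C₁ (A, B)`: the minimum of `C(x)` over all Nash equilibria `(x, y)`. -/
def minComplexity₁ {n : ℕ} (A B : Matrix (Fin n) (Fin n) ℤ) : ℕ∞ :=
  ⨅ p ∈ nashEquilibria A B, complexity p.1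

/-- `C₂ (A, B)`: the minimum of `C(y)` over all Nash equilibria `(x, y)`. -/
def minComplexity₂ {n : ℕ} (A B : Matrix (Fin n) (Fin n) ℤ) : ℕ∞ :=
  ⨅ p ∈ nashEquilibria A B, complexity p.2

/-- All entries lie in `{0, 1}`. -/
def IsBinary {n : ℕ} (A : Matrix (Fin n) (Fin n) ℤ) : Prop :=
  ∀ i j, A i j = 0 ∨ A i j = 1

/-- The all-ones matrix. -/
def ones (n : ℕ) : Matrix (Fin n) (Fin n) ℤ :=
  Matrix.of fun _ _ => 1

/-- The banded matrix `Bₙ`, with ones exactly on the main diagonal, on the first diagonal above it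
and on the second diagonal below it. -/
def bandMatrix (n : ℕ) : Matrix (Fin n) (Fin n) ℤ :=
  Matrix.of fun i j =>
    if (j : ℕ) = i ∨ (j : ℕ) = i + 1 ∨ (i : ℕ) = j + 2 then 1 else 0

/-- The matrix `βₙ` with block form `[0, Bₙ₋₁; 1, 0]`: its first `n - 1` rows are `0` followed by
the rows of `Bₙ₋₁`, and its last row is `(1, 0, …, 0)`. -/
def beta : (n : ℕ) → Matrix (Fin n) (Fin n) ℤ
  | 0 => 0
  | m + 1 => Matrix.of
      (Fin.snoc (α := fun _ => Fin (m + 1) → ℤ)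
        (fun i => Fin.cons (α := fun _ => ℤ) 0 (bandMatrix m i))
        (Fin.cons (α := fun _ => ℤ) 1 (fun _ => 0)))

/-- `K(A)`, the sum of all cofactors of `A` (the adjugate is the transposed cofactor matrix). -/
def cofactorSum {n : ℕ} (A : Matrix (Fin n) (Fin n) ℤ) : ℤ :=
  ∑ i, ∑ j, A.adjugate i j

/-- The linear recurrence `b₁ = 0, b₂ = 1, b₃ = 0, b₄ = 1` and `bₙ = bₙ₋₂ - bₙ₋₃ + bₙ₋₄` for
`n ≥ 5`; the value at index `0` is not used. -/
def bSeq : ℕ → ℤ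
  | 0 => 0
  | 1 => 0
  | 2 => 1
  | 3 => 0
  | 4 => 1
  | n + 5 => bSeq (n + 3) - bSeq (n + 2) + bSeq (n + 1)

end

end RandomGames

namespace RandomGames

/-! In the game `(1, B)` player 1 wins by matching player 2. At an equilibrium every strategy in the
support of `x` therefore maximizes `y`, so player 2 plays it, and it is a best reply to `x`. If only
fully supported `x` can be supported on best replies to themselves, then `y` is uniform and `x`
equalizes the columns of `B`, which determines `x` when `B` is invertible (`nashEquilibria_one`). In
the constant-sum game, positive equalizing strategies on both sides and invertibility exclude every
other equilibrium (`nashEquilibria_ones_sub`); since `beta` is symmetric about its antidiagonal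
(`beta_rev`), the strategy of player 2 is the reversal of `x`.

For `beta`, equalizing, read backwards, is the recurrence `u (k + 3) + u (k + 2) + u k = V` with two
zeros at the start and one at the end. Its solutions are combinations of values of `bSeq`
(`recSeq_eq`), and the end condition fixes the ratio of the free parameter to `V` as `|bₙ| : |bₙ| +
|bₙ₊₁|`. The resulting integral vector has gcd `gcd(bₙ, bₙ₊₁)` (`gcd_equalizer`) and sum `|K(βₙ)|`
(`sum_equalizer_eq`). It is nonnegative by a minimum principle (`recSeq_nonneg`), and positive
because equalizing vectors satisfy the support condition (`forall_pos_of_vecMul_beta`).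

The sum lies between `d = |bₙ| + |bₙ₊₁|` and `n * d`, and `d` grows exponentially, so only a large
gcd could spoil the growth. The form `u³ + u²w + w³` is odd at coprime pairs, so the cube of the gcd
is at most its absolute value at `(bₙ₊₁, bₙ)`. Its real linear factor stays bounded along the
sequence, so that value is `O(d²)`, the gcd is `O(d^(2/3))`, and the complexity is at least a
constant times `d^(1/3)`. For `n = 3, 6, 7` cyclic permutation matrices replace `beta`. -/

/-! ### Equilibria and complementary slackness -/

theorem eq_of_dotProduct_eq_of_le {n : ℕ} {x f : Fin n → ℝ} {V : ℝ} (hx : x ∈ stdSimplex ℝ (Fin n))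
    (hf : ∀ i, f i ≤ V) (h : x ⬝ᵥ f = V) (i : Fin n) (hi : 0 < x i) : f i = V := by
  have h0 : ∑ j, x j * (V - f j) = 0 := by
    simp only [mul_sub, Finset.sum_sub_distrib, ← Finset.sum_mul, hx.2]
    rw [dotProduct] at h
    linarith
  have h1 := (Finset.sum_eq_zero_iff_of_nonneg
    (fun j _ => mul_nonneg (hx.1 j) (sub_nonneg.2 (hf j)))).1 h0 i (Finset.mem_univ i)
  rcases mul_eq_zero.1 h1 with h2 | h2 <;> linarith

theorem eq_of_dotProduct_eq_of_ge {n : ℕ} {x f : Fin n → ℝ} {V : ℝ} (hx : x ∈ stdSimplex ℝ (Fin n))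
    (hf : ∀ i, V ≤ f i) (h : x ⬝ᵥ f = V) (i : Fin n) (hi : 0 < x i) : f i = V := by
  have := eq_of_dotProduct_eq_of_le (f := -f) (V := -V) hx (fun i => neg_le_neg (hf i))
    (by rw [dotProduct_neg, h]) i hi
  simpa using this

theorem dotProduct_le_of_mem_stdSimplex {n : ℕ} {x f : Fin n → ℝ} {V : ℝ}
    (hx : x ∈ stdSimplex ℝ (Fin n)) (hf : ∀ i, f i ≤ V) : x ⬝ᵥ f ≤ V := by
  calc x ⬝ᵥ f ≤ ∑ i, x i * V :=
        Finset.sum_le_sum fun i _ => mul_le_mul_of_nonneg_left (hf i) (hx.1 i)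
    _ = V := by rw [← Finset.sum_mul, hx.2, one_mul]

theorem le_dotProduct_of_mem_stdSimplex {n : ℕ} {x f : Fin n → ℝ} {V : ℝ}
    (hx : x ∈ stdSimplex ℝ (Fin n)) (hf : ∀ i, V ≤ f i) : V ≤ x ⬝ᵥ f := by
  have := dotProduct_le_of_mem_stdSimplex (f := -f) (V := -V) hx fun i => neg_le_neg (hf i)
  rw [dotProduct_neg] at this
  linarith

theorem dotProduct_const_of_mem_stdSimplex {n : ℕ} {x : Fin n → ℝ}
    (hx : x ∈ stdSimplex ℝ (Fin n)) (v : ℝ) : (x ⬝ᵥ fun _ => v) = v := by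
  rw [dotProduct, ← Finset.sum_mul, hx.2, one_mul]

theorem payoff_eq_vecMul {n : ℕ} (A : Matrix (Fin n) (Fin n) ℤ) (x y : Fin n → ℝ) :
    payoff A x y = y ⬝ᵥ (x ᵥ* A.map (Int.cast : ℤ → ℝ)) := by
  rw [payoff, Matrix.dotProduct_mulVec, dotProduct_comm]

theorem exists_pos_of_mem_stdSimplex {n : ℕ} {x : Fin n → ℝ} (hx : x ∈ stdSimplex ℝ (Fin n)) :
    ∃ i, 0 < x i := by
  by_contra! h
  have := Finset.sum_nonpos fun i (_ : i ∈ Finset.univ) => h i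
  rw [hx.2] at this
  linarith

/-- A pair of distributions is an equilibrium iff no pure strategy improves on it. -/
theorem mem_nashEquilibria_iff {n : ℕ} {A B : Matrix (Fin n) (Fin n) ℤ} {x y : Fin n → ℝ} :
    (x, y) ∈ nashEquilibria A B ↔ x ∈ stdSimplex ℝ (Fin n) ∧ y ∈ stdSimplex ℝ (Fin n) ∧
      (∀ i, (A.map (Int.cast : ℤ → ℝ) *ᵥ y) i ≤ payoff A x y) ∧
      (∀ j, (x ᵥ* B.map (Int.cast : ℤ → ℝ)) j ≤ payoff B x y) := by
  constructor
  · rintro ⟨hx, hy, h1, h2⟩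
    refine ⟨hx, hy, fun i => ?_, fun j => ?_⟩
    · simpa [payoff] using h1 _ (single_mem_stdSimplex ℝ i)
    · simpa [payoff_eq_vecMul] using h2 _ (single_mem_stdSimplex ℝ j)
  · rintro ⟨hx, hy, h1, h2⟩
    refine ⟨hx, hy, fun x' hx' => dotProduct_le_of_mem_stdSimplex hx' h1, fun y' hy' => ?_⟩
    rw [payoff_eq_vecMul B x y']
    exact dotProduct_le_of_mem_stdSimplex hy' h2

theorem ones_sub_map_mulVec {n : ℕ} (B : Matrix (Fin n) (Fin n) ℤ) {y : Fin n → ℝ}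
    (hy : y ∈ stdSimplex ℝ (Fin n)) (i : Fin n) :
    ((ones n - B).map (Int.cast : ℤ → ℝ) *ᵥ y) i = 1 - (B.map (Int.cast : ℤ → ℝ) *ᵥ y) i := by
  simp [Matrix.mulVec, dotProduct, ones, sub_mul, Finset.sum_sub_distrib, hy.2]

theorem payoff_ones_sub {n : ℕ} (B : Matrix (Fin n) (Fin n) ℤ) {x y : Fin n → ℝ}
    (hx : x ∈ stdSimplex ℝ (Fin n)) (hy : y ∈ stdSimplex ℝ (Fin n)) :
    payoff (ones n - B) x y = 1 - payoff B x y := by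
  have : (ones n - B).map (Int.cast : ℤ → ℝ) *ᵥ y
      = fun i => 1 - (B.map (Int.cast : ℤ → ℝ) *ᵥ y) i := funext (ones_sub_map_mulVec B hy)
  simp [payoff, this, dotProduct, mul_sub, Finset.sum_sub_distrib, hx.2]

/-- A constant-sum game with an invertible payoff matrix and fully supported equalizing strategies
has no other equilibrium. -/
theorem nashEquilibria_ones_sub {n : ℕ} {B : Matrix (Fin n) (Fin n) ℤ} (hB : B.det ≠ 0)
    {x y : Fin n → ℝ} {v : ℝ} (hx : x ∈ stdSimplex ℝ (Fin n)) (hy : y ∈ stdSimplex ℝ (Fin n))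
    (hx0 : ∀ i, 0 < x i) (hy0 : ∀ i, 0 < y i)
    (hxB : x ᵥ* B.map (Int.cast : ℤ → ℝ) = fun _ => v)
    (hBy : B.map (Int.cast : ℤ → ℝ) *ᵥ y = fun _ => v) :
    nashEquilibria (ones n - B) B = {(x, y)} := by
  have hdet : IsUnit (B.map (Int.cast : ℤ → ℝ)) := by
    rw [Matrix.isUnit_iff_isUnit_det]
    have : (B.map (Int.cast : ℤ → ℝ)).det = (B.det : ℝ) := (Int.cast_det B).symm
    rw [this, isUnit_iff_ne_zero]
    exact_mod_cast hB
  ext ⟨x', y'⟩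
  rw [mem_nashEquilibria_iff, Set.mem_singleton_iff]
  constructor
  · rintro ⟨hx', hy', h1, h2⟩
    simp only [ones_sub_map_mulVec B hy', payoff_ones_sub B hx' hy'] at h1
    have e1 : y ⬝ᵥ (x' ᵥ* B.map (Int.cast : ℤ → ℝ)) = v := by
      rw [← payoff_eq_vecMul, payoff, hBy, dotProduct_const_of_mem_stdSimplex hx']
    have e2 : x ⬝ᵥ (B.map (Int.cast : ℤ → ℝ) *ᵥ y') = v := by
      rw [← payoff, payoff_eq_vecMul, hxB, dotProduct_const_of_mem_stdSimplex hy']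
    -- Testing the new equilibrium against the equalizing pair bounds its payoff on both sides by
    -- `v`. Full support of that pair then makes every best-reply inequality an equality.
    have i1 := dotProduct_le_of_mem_stdSimplex hy h2
    have i2 := le_dotProduct_of_mem_stdSimplex hx
      (f := B.map (Int.cast : ℤ → ℝ) *ᵥ y') (V := payoff B x' y') fun i => by linarith [h1 i]
    have hV : payoff B x' y' = v := by linarith
    have a1 : x' ᵥ* B.map (Int.cast : ℤ → ℝ) = x ᵥ* B.map (Int.cast : ℤ → ℝ) := by
      rw [hxB]
      exact funext fun j => eq_of_dotProduct_eq_of_le hy (fun j => hV ▸ h2 j) e1 j (hy0 j)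
    have a2 : B.map (Int.cast : ℤ → ℝ) *ᵥ y' = B.map (Int.cast : ℤ → ℝ) *ᵥ y := by
      rw [hBy]
      exact funext fun j => eq_of_dotProduct_eq_of_ge hx (fun j => by linarith [h1 j]) e2 j (hx0 j)
    rw [Matrix.vecMul_injective_of_isUnit hdet a1, Matrix.mulVec_injective_of_isUnit hdet a2]
  · rintro h
    obtain ⟨rfl, rfl⟩ := Prod.mk.inj h
    have hp : payoff B x' y' = v := by
      rw [payoff, hBy, dotProduct_const_of_mem_stdSimplex hx]
    refine ⟨hx, hy, fun i => ?_, fun j => ?_⟩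
    · rw [ones_sub_map_mulVec B hy, payoff_ones_sub B hx hy, hp, hBy]
    · rw [hp, hxB]

theorem uniform_mem_stdSimplex (m : ℕ) :
    (fun _ => ((m + 1 : ℕ) : ℝ)⁻¹) ∈ stdSimplex ℝ (Fin (m + 1)) := by
  refine ⟨fun _ => by positivity, ?_⟩
  rw [Finset.sum_const, Finset.card_univ, Fintype.card_fin, nsmul_eq_mul]
  exact mul_inv_cancel₀ (by positivity)

theorem payoff_one {n : ℕ} (x y : Fin n → ℝ) :
    payoff 1 x y = x ⬝ᵥ y := by
  rw [payoff, Matrix.map_one _ Int.cast_zero Int.cast_one, Matrix.one_mulVec]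

/-- The game `(1, B)`, in which player 1 wants to imitate player 2: it has exactly one equilibrium
if `B` is invertible, `x` is an equalizing strategy, and every strategy of player 1 that is
supported on best replies to itself has full support. -/
theorem nashEquilibria_one {m : ℕ} {B : Matrix (Fin (m + 1)) (Fin (m + 1)) ℤ} (hB : B.det ≠ 0)
    {x : Fin (m + 1) → ℝ} {v : ℝ} (hx : x ∈ stdSimplex ℝ (Fin (m + 1)))
    (hxB : x ᵥ* B.map (Int.cast : ℤ → ℝ) = fun _ => v)
    (hsupp : ∀ x' ∈ stdSimplex ℝ (Fin (m + 1)), ∀ V : ℝ,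
      (∀ j, (x' ᵥ* B.map (Int.cast : ℤ → ℝ)) j ≤ V) →
      (∀ j, 0 < x' j → (x' ᵥ* B.map (Int.cast : ℤ → ℝ)) j = V) → ∀ j, 0 < x' j) :
    nashEquilibria 1 B = {(x, fun _ => ((m + 1 : ℕ) : ℝ)⁻¹)} := by
  have hdet : IsUnit (B.map (Int.cast : ℤ → ℝ)) := by
    rw [Matrix.isUnit_iff_isUnit_det]
    have : (B.map (Int.cast : ℤ → ℝ)).det = (B.det : ℝ) := (Int.cast_det B).symm
    rw [this, isUnit_iff_ne_zero]
    exact_mod_cast hB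
  ext ⟨x', y'⟩
  rw [mem_nashEquilibria_iff, Set.mem_singleton_iff, payoff_one,
    Matrix.map_one _ Int.cast_zero Int.cast_one, Matrix.one_mulVec]
  constructor
  · rintro ⟨hx', hy', h1, h2⟩
    have s1 : ∀ i, 0 < x' i → y' i = x' ⬝ᵥ y' := eq_of_dotProduct_eq_of_le hx' h1 rfl
    have s2 := eq_of_dotProduct_eq_of_le hy' h2 (payoff_eq_vecMul B x' y').symm
    -- The maximum of `y'` is positive, so the support of `x'` lies inside that of `y'`, hence among
    -- the best replies to `x'`.
    have hM : 0 < x' ⬝ᵥ y' := by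
      obtain ⟨i, hi⟩ := exists_pos_of_mem_stdSimplex hy'
      exact hi.trans_le (h1 i)
    have hpos : ∀ j, 0 < x' j :=
      hsupp x' hx' _ h2 fun j hj => s2 j (by rw [s1 j hj]; exact hM)
    have hy1 : y' = fun _ => x' ⬝ᵥ y' := funext fun j => s1 j (hpos j)
    have hM1 : x' ⬝ᵥ y' = ((m + 1 : ℕ) : ℝ)⁻¹ := by
      have h3 : ∑ i, y' i = 1 := hy'.2
      rw [Finset.sum_congr rfl fun i _ => s1 i (hpos i), Finset.sum_const, Finset.card_univ,
        Fintype.card_fin, nsmul_eq_mul] at h3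
      exact eq_inv_of_mul_eq_one_right h3
    have hxV : x' ᵥ* B.map (Int.cast : ℤ → ℝ) = fun _ => payoff B x' y' :=
      funext fun j => s2 j (by rw [s1 j (hpos j)]; exact hM)
    have hV : x' = (payoff B x' y' / v) • x ∨ v = 0 := by
      by_cases hv : v = 0
      · exact Or.inr hv
      refine Or.inl (Matrix.vecMul_injective_of_isUnit hdet ?_)
      simp only [Matrix.smul_vecMul]
      rw [hxV, hxB]
      ext
      simp [hv]
    have hv : v ≠ 0 := by
      rintro rfl
      have : x = 0 := Matrix.vecMul_injective_of_isUnit hdet <| by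
        simp only [hxB, Matrix.zero_vecMul]
        rfl
      have h4 := hx.2
      simp [this] at h4
    have hx'' := hV.resolve_right hv
    have h5 : payoff B x' y' / v = 1 := by
      have h6 : ∑ i, x' i = 1 := hx'.2
      rw [Finset.sum_congr rfl fun i _ => congrFun hx'' i] at h6
      simp only [Pi.smul_apply, smul_eq_mul, ← Finset.mul_sum, hx.2, mul_one] at h6
      exact h6
    rw [h5, one_smul] at hx''
    rw [hM1] at hy1
    rw [hx'', hy1]
  · rintro h
    obtain ⟨rfl, rfl⟩ := Prod.mk.inj h
    refine ⟨hx, uniform_mem_stdSimplex m, fun i => ?_, fun j => ?_⟩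
    · rw [dotProduct_const_of_mem_stdSimplex hx]
    · rw [payoff_eq_vecMul, hxB,
        dotProduct_const_of_mem_stdSimplex (uniform_mem_stdSimplex m)]

/-! ### Complexity of explicit vectors -/

theorem complexity_uniform (m : ℕ) :
    complexity (fun _ : Fin (m + 1) => ((m + 1 : ℕ) : ℝ)⁻¹) = ((m + 1 : ℕ) : ℕ∞) := by
  refine complexity_eq (p := fun _ => 1) m.succ_pos ?_ fun i => by simp
  exact Nat.dvd_one.1 (Finset.gcd_dvd (Finset.mem_univ (0 : Fin (m + 1))))

/-- The complexity of the normalization of a vector of natural numbers. -/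
theorem complexity_div_sum {n : ℕ} {X : Fin n → ℕ} (hX : 0 < ∑ i, X i) :
    complexity (fun i => (X i : ℝ) / ((∑ j, X j : ℕ) : ℝ))
      = (((∑ i, X i) / Finset.univ.gcd X : ℕ) : ℕ∞) := by
  have hd : ∀ i, Finset.univ.gcd X ∣ X i := fun i => Finset.gcd_dvd (Finset.mem_univ i)
  obtain ⟨i, -, hi⟩ := Finset.exists_ne_zero_of_sum_ne_zero hX.ne'
  have h0 : 0 < Finset.univ.gcd X := Nat.pos_of_dvd_of_pos (hd i) (Nat.pos_of_ne_zero hi)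
  have hs : Finset.univ.gcd X ∣ ∑ i, X i := Finset.dvd_sum fun i _ => hd i
  refine complexity_eq (p := fun i => X i / Finset.univ.gcd X)
    (Nat.div_pos (Nat.le_of_dvd hX hs) h0) (Finset.gcd_div_eq_one (Finset.mem_univ i) hi)
    fun j => ?_
  rw [Nat.cast_div (hd j) (by positivity), Nat.cast_div hs (by positivity),
    div_div_div_cancel_right₀ (by positivity)]

theorem minComplexity₁_of_singleton {n : ℕ} {A B : Matrix (Fin n) (Fin n) ℤ} {x y : Fin n → ℝ}
    (h : nashEquilibria A B = {(x, y)}) : minComplexity₁ A B = complexity x := by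
  simp [minComplexity₁, h]

theorem minComplexity₂_of_singleton {n : ℕ} {A B : Matrix (Fin n) (Fin n) ℤ} {x y : Fin n → ℝ}
    (h : nashEquilibria A B = {(x, y)}) : minComplexity₂ A B = complexity y := by
  simp [minComplexity₂, h]

theorem IsBinary.ones_sub {n : ℕ} {B : Matrix (Fin n) (Fin n) ℤ} (hB : IsBinary B) :
    IsBinary (ones n - B) := by
  intro i j
  rcases hB i j with h | h <;> simp [ones, h]

theorem isBinary_one (n : ℕ) : IsBinary (1 : Matrix (Fin n) (Fin n) ℤ) := by
  intro i j
  by_cases h : i = j <;> simp [Matrix.one_apply, h]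

/-! ### Cyclic permutation matrices, for the exceptional sizes -/

/-- The matrix of a cyclic permutation. -/
def cyclicMatrix (m : ℕ) : Matrix (Fin (m + 1)) (Fin (m + 1)) ℤ :=
  (1 : Matrix (Fin (m + 1)) (Fin (m + 1)) ℤ).submatrix id (Equiv.addRight (1 : Fin (m + 1)))

theorem isBinary_cyclicMatrix (m : ℕ) : IsBinary (cyclicMatrix m) :=
  fun i j => isBinary_one _ i (j + 1)

theorem det_cyclicMatrix_ne_zero (m : ℕ) : (cyclicMatrix m).det ≠ 0 := by
  have h := Matrix.abs_det_submatrix_equiv_equiv (Equiv.refl _) (Equiv.addRight (1 : Fin (m + 1)))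
    (1 : Matrix (Fin (m + 1)) (Fin (m + 1)) ℤ)
  rw [Matrix.det_one, abs_one] at h
  exact abs_ne_zero.1 (ne_of_eq_of_ne h one_ne_zero)

theorem vecMul_cyclicMatrix (m : ℕ) (x : Fin (m + 1) → ℝ) (j : Fin (m + 1)) :
    (x ᵥ* (cyclicMatrix m).map (Int.cast : ℤ → ℝ)) j = x (j + 1) := by
  simp [Matrix.vecMul, dotProduct, cyclicMatrix, Matrix.one_apply]

theorem cyclicMatrix_mulVec_const (m : ℕ) (c : ℝ) :
    (cyclicMatrix m).map (Int.cast : ℤ → ℝ) *ᵥ (fun _ => c) = fun _ => c := by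
  ext i
  have : ∀ j : Fin (m + 1), i = j + 1 ↔ i - 1 = j := fun j => by rw [sub_eq_iff_eq_add]
  simp [Matrix.mulVec, dotProduct, cyclicMatrix, Matrix.one_apply, this]

open Fin.NatCast in
theorem nashEquilibria_one_cyclicMatrix (m : ℕ) :
    nashEquilibria 1 (cyclicMatrix m)
      = {(fun _ => ((m + 1 : ℕ) : ℝ)⁻¹, fun _ => ((m + 1 : ℕ) : ℝ)⁻¹)} := by
  refine nashEquilibria_one (det_cyclicMatrix_ne_zero m) (uniform_mem_stdSimplex m)
    (v := ((m + 1 : ℕ) : ℝ)⁻¹) (funext fun j => vecMul_cyclicMatrix m _ j) ?_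
  intro x hx V h1 h2
  simp only [vecMul_cyclicMatrix] at h1 h2
  obtain ⟨i, hi⟩ := exists_pos_of_mem_stdSimplex hx
  have hV : 0 < V := hi.trans_le (by simpa using h1 (i - 1))
  -- Column `j` pays `x (j + 1)`, so a positive `x j` forces `x (j + 1) = V > 0`; positivity travels
  -- around the cycle.
  have h3 : ∀ k : ℕ, 0 < x (i + (k : Fin (m + 1))) := by
    intro k
    induction k with
    | zero => simpa using hi
    | succ k ih =>
      have := h2 _ ih
      rw [add_assoc] at this
      rw [Nat.cast_succ, this]
      exact hV
  intro j
  simpa using h3 ((j - i : Fin (m + 1)) : ℕ)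

theorem nashEquilibria_ones_sub_cyclicMatrix (m : ℕ) :
    nashEquilibria (ones (m + 1) - cyclicMatrix m) (cyclicMatrix m)
      = {(fun _ => ((m + 1 : ℕ) : ℝ)⁻¹, fun _ => ((m + 1 : ℕ) : ℝ)⁻¹)} :=
  nashEquilibria_ones_sub (det_cyclicMatrix_ne_zero m) (uniform_mem_stdSimplex m)
    (uniform_mem_stdSimplex m) (fun _ => by positivity) (fun _ => by positivity)
    (v := ((m + 1 : ℕ) : ℝ)⁻¹) (funext fun j => vecMul_cyclicMatrix m _ j)
    (cyclicMatrix_mulVec_const m _)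

/-! ### Strategies supported on their own best replies -/

/-- `p` stands for the reversed strategy without its last coordinate `w`, preceded by two zeros. -/
theorem support_eq_univ {m : ℕ} (hm2 : m ≠ 2) (hm5 : m ≠ 5) (hm6 : m ≠ 6) (hm : 0 < m)
    {p : ℕ → ℝ} {w V : ℝ} (hV : 0 < V) (h0 : ∀ j, 0 ≤ p j) (hp0 : p 0 = 0) (hp1 : p 1 = 0)
    (hend : ∀ j, m + 2 ≤ j → p j = 0)
    (hle : ∀ j, j < m → p j + p (j + 2) + p (j + 3) ≤ V)
    (heq : ∀ j, j < m → 0 < p (j + 1) → p j + p (j + 2) + p (j + 3) = V)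
    (heq0 : 0 < w → p 2 + p 3 = V)
    (heqm : 0 < p (m + 1) → w = V)
    (hne : 0 < w ∨ ∃ j, 0 < p j) :
    0 < w ∧ ∀ j, 2 ≤ j → j ≤ m + 1 → 0 < p j := by
  -- If the largest `j` with `p j > 0` were at most `m`, tightness at `j - 1` would give `p (j - 1)
  -- = V`, and the inequality at `j - 3` would leave no room for `p j`; for `j = 2` tightness
  -- already reads `0 = V`.
  have hlast : 0 < p (m + 1) := by
    by_contra hlast
    have hlast' : p (m + 1) = 0 := le_antisymm (not_lt.1 hlast) (h0 _)
    have hall : ∀ k, p (m + 1 - k) = 0 := by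
      intro k
      induction k using Nat.strong_induction_on with
      | _ k ih =>
      by_contra hk
      have hkp : 0 < p (m + 1 - k) := lt_of_le_of_ne (h0 _) (Ne.symm hk)
      have hk0 : k ≠ 0 := by
        rintro rfl
        exact hk hlast'
      obtain ⟨j, hj⟩ : ∃ j, m + 1 - k = j := ⟨_, rfl⟩
      have hz : ∀ i, j < i → p i = 0 := by
        intro i hi
        by_cases him : m + 2 ≤ i
        · exact hend i him
        · have := ih (m + 1 - i) (by omega)
          rwa [show m + 1 - (m + 1 - i) = i by omega] at this
      rw [hj] at hkp
      match j, hj, hkp, hz with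
      | 0, _, hkp, _ => linarith
      | 1, _, hkp, _ => linarith
      | 2, hj, hkp, hz =>
        have := heq 1 (by omega) hkp
        linarith [hz 3 (by omega), hz 4 (by omega)]
      | j + 3, hj, hkp, hz =>
        have e1 := heq (j + 2) (by omega) hkp
        have e2 := hle j (by omega)
        have e3 := hz (j + 2 + 2) (by omega)
        have e4 := hz (j + 2 + 3) (by omega)
        linarith [h0 j]
    have hall' : ∀ j, p j = 0 := by
      intro j
      by_cases hj : m + 2 ≤ j
      · exact hend j hj
      · have := hall (m + 1 - j)
        rwa [show m + 1 - (m + 1 - j) = j by omega] at this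
    rcases hne with hw | ⟨j, hj⟩
    · have := heq0 hw
      linarith [hall' 2, hall' 3]
    · linarith [hall' j]
  have hwV := heqm hlast
  have hwp : 0 < w := by linarith
  refine ⟨hwp, ?_⟩
  have c0 := heq0 hwp
  intro j
  induction j using Nat.strong_induction_on with
  | _ j ih =>
  intro hj2 hjm
  by_contra hj
  have hpj : p j = 0 := le_antisymm (not_lt.1 hj) (h0 _)
  have hjm' : j ≤ m := by
    by_contra hcon
    have : j = m + 1 := by omega
    rw [this] at hpj
    linarith
  have pos : ∀ i, 2 ≤ i → i < j → 0 < p i := fun i h2 hi => ih i hi h2 (by omega)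
  have E := fun i (hi : i < m) => heq i hi
  -- Here `j` is the least index from `2` on with `p j = 0`, so the equations before it are tight.
  -- The excluded `m = 2, 5, 6` are genuine exceptions: there the equalizing vector vanishes at
  -- index `2, 5, 6` respectively.
  match j, hj2, hjm', hpj, pos with
  | 2, _, hjm, hpj, _ =>
    have i1 := hle 1 (by omega)
    have e2 := heq 2 (by omega) (by simp only [Nat.reduceAdd]; linarith)
    simp only [Nat.reduceAdd] at i1 e2
    by_cases h3 : 3 < m
    · have i3 := hle 3 h3
      simp only [Nat.reduceAdd] at i3
      linarith [h0 4, h0 6]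
    · linarith [hend 5 (by omega), h0 4]
  | 3, _, hjm, hpj, pos =>
    have e1 := heq 1 (by omega) (pos 2 (by omega) (by omega))
    have i2 := hle 2 (by omega)
    simp only [Nat.reduceAdd] at e1 i2
    linarith [h0 5]
  | 4, _, hjm, hpj, pos =>
    have p2 := pos 2 (by omega) (by omega)
    have e1 := heq 1 (by omega) p2
    simp only [Nat.reduceAdd] at e1
    linarith
  | 5, _, hjm, hpj, pos =>
    have p2 := pos 2 (by omega) (by omega)
    have p3 := pos 3 (by omega) (by omega)
    have p4 := pos 4 (by omega) (by omega)
    have e1 := heq 1 (by omega) p2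
    have e2 := heq 2 (by omega) p3
    have e3 := heq 3 (by omega) p4
    have i4 := hle 4 (by omega)
    have e5 := heq 5 (by omega)
    have i6 := hle 6 (by omega)
    simp only [Nat.reduceAdd] at e1 e2 e3 i4 e5 i6
    have e5' := e5 (by linarith)
    linarith [h0 7, h0 9]
  | 6, _, hjm, hpj, pos =>
    have p2 := pos 2 (by omega) (by omega)
    have p3 := pos 3 (by omega) (by omega)
    have p4 := pos 4 (by omega) (by omega)
    have p5 := pos 5 (by omega) (by omega)
    have e1 := heq 1 (by omega) p2
    have e2 := heq 2 (by omega) p3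
    have e3 := heq 3 (by omega) p4
    have e4 := heq 4 (by omega) p5
    have i5 := hle 5 (by omega)
    have e6 := heq 6 (by omega)
    simp only [Nat.reduceAdd] at e1 e2 e3 e4 i5 e6
    have e6' := e6 (by linarith)
    by_cases h7 : 7 < m
    · have i7 := hle 7 h7
      simp only [Nat.reduceAdd] at i7
      linarith [h0 8, h0 10]
    · linarith [hend 9 (by omega), h0 8]
  -- With `p (j + 7) = 0`, the combination `e5 + e4 - e2` gives `p (j + 6) + p (j + 8) = V + p (j +
  -- 2) > V`, against `i6`.
  | j + 7, _, hjm, hpj, pos =>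
    have i6 := hle (j + 6) (by omega)
    have e5 := heq (j + 5) (by omega) (pos _ (by omega) (by omega))
    have e4 := heq (j + 4) (by omega) (pos _ (by omega) (by omega))
    have e2 := heq (j + 2) (by omega) (pos _ (by omega) (by omega))
    have p2 := pos (j + 2) (by omega) (by omega)
    simp only [add_assoc, Nat.reduceAdd] at i6 e5 e4 e2
    linarith [h0 (j + 9)]

/-! ### The sequence `b` -/

/-- The defining fourth-order recurrence is the difference of two consecutive instances of this one;
the initial values fix the constant as `1`. -/
theorem bSeq_add_three (n : ℕ) : bSeq (n + 3) = 1 - bSeq (n + 2) - bSeq n := by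
  induction n using Nat.strong_induction_on with
  | _ n ih =>
  match n, ih with
  | 0, _ => simp [bSeq]
  | 1, _ => simp [bSeq]
  | n + 2, ih =>
    have h1 := ih (n + 1) (by omega)
    have h2 : bSeq (n + 2 + 3) = bSeq (n + 3) - bSeq (n + 2) + bSeq (n + 1) := by rw [bSeq]
    rw [h2]
    simp only [add_assoc, Nat.reduceAdd] at h1 ⊢
    linarith

/-- The absolute value of `bSeq n`. -/
def absSeq (n : ℕ) : ℤ := (-1) ^ n * bSeq n

theorem absSeq_add_three (n : ℕ) :
    absSeq (n + 3) = absSeq (n + 2) + absSeq n - (-1) ^ n := by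
  simp only [absSeq, bSeq_add_three, pow_add]
  ring

theorem one_le_absSeq (n : ℕ) : 1 ≤ absSeq (n + 4) := by
  induction n using Nat.strong_induction_on with
  | _ n ih =>
  match n, ih with
  | 0, _ => simp [absSeq, bSeq]
  | 1, _ => simp [absSeq, bSeq]
  | 2, _ => simp [absSeq, bSeq]
  | n + 3, ih =>
    have h1 := ih n (by omega)
    have h2 := ih (n + 2) (by omega)
    have h3 := absSeq_add_three (n + 4)
    have h4 : ((-1 : ℤ)) ^ (n + 4) ≤ 1 := by
      rcases neg_one_pow_eq_or ℤ (n + 4) with h | h <;> simp [h]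
    simp only [add_assoc, Nat.reduceAdd] at h1 h2 h3 ⊢
    linarith

theorem absSeq_nonneg (n : ℕ) : 0 ≤ absSeq n := by
  match n with
  | 0 => simp [absSeq, bSeq]
  | 1 => simp [absSeq, bSeq]
  | 2 => simp [absSeq, bSeq]
  | 3 => simp [absSeq, bSeq]
  | n + 4 => linarith [one_le_absSeq n]

theorem absSeq_eq_abs (n : ℕ) : absSeq n = |bSeq n| := by
  rw [← abs_of_nonneg (absSeq_nonneg n), absSeq, abs_mul, abs_pow, abs_neg, abs_one, one_pow,
    one_mul]

/-- The absolute value of `bSeq (n + 1) - bSeq n`, which is that of the determinant of `beta n`. -/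
def diffSeq (n : ℕ) : ℤ := absSeq n + absSeq (n + 1)

theorem diffSeq_eq (n : ℕ) : diffSeq n = (-1) ^ (n + 1) * (bSeq (n + 1) - bSeq n) := by
  simp only [diffSeq, absSeq, pow_succ]
  ring

theorem diffSeq_add_three (n : ℕ) : diffSeq (n + 3) = diffSeq (n + 2) + diffSeq n := by
  have h1 := absSeq_add_three n
  have h2 := absSeq_add_three (n + 1)
  simp only [diffSeq, add_assoc, Nat.reduceAdd, pow_succ] at *
  linarith

theorem diffSeq_nonneg (n : ℕ) : 0 ≤ diffSeq n :=
  add_nonneg (absSeq_nonneg n) (absSeq_nonneg _)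

theorem diffSeq_pos (n : ℕ) : 0 < diffSeq (n + 1) := by
  match n with
  | 0 => simp [diffSeq, absSeq, bSeq]
  | 1 => simp [diffSeq, absSeq, bSeq]
  | 2 => simp [diffSeq, absSeq, bSeq]
  | n + 3 => linarith [one_le_absSeq n, absSeq_nonneg (n + 3 + 1 + 1),
      show diffSeq (n + 3 + 1) = absSeq (n + 4) + absSeq (n + 3 + 1 + 1) from rfl]

theorem diffSeq_mono {i j : ℕ} (h : i ≤ j) : diffSeq i ≤ diffSeq j := by
  refine monotone_nat_of_le_succ (fun n => ?_) h
  match n with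
  | 0 => simp [diffSeq, absSeq, bSeq]
  | 1 => simp [diffSeq, absSeq, bSeq]
  | n + 2 => linarith [diffSeq_add_three n, diffSeq_nonneg n]

/-! ### The equalizing recurrence and its minimum principle -/

/-- The integral solution of `u (k + 3) + u (k + 2) + u k = V` with given initial values. -/
def recSeq (a V : ℤ) : ℕ → ℤ
  | 0 => a
  | 1 => V
  | 2 => V - a
  | k + 3 => V - recSeq a V (k + 2) - recSeq a V k

theorem recSeq_add_three (a V : ℤ) (k : ℕ) :
    recSeq a V (k + 3) = V - recSeq a V (k + 2) - recSeq a V k := by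
  rw [recSeq]

theorem recSeq_eq (a V : ℤ) (k : ℕ) :
    recSeq a V (k + 4) = a * (bSeq (k + 1) - bSeq k) + V * bSeq k := by
  induction k using Nat.strong_induction_on with
  | _ k ih =>
  match k, ih with
  | 0, _ => simp [recSeq, bSeq]
  | 1, _ => simp [recSeq, bSeq]
  | 2, _ =>
    simp [recSeq, bSeq]
    ring
  | k + 3, ih =>
    have h1 := ih k (by omega)
    have h2 := ih (k + 2) (by omega)
    have h3 := recSeq_add_three a V (k + 4)
    have h4 := bSeq_add_three k
    have h5 := bSeq_add_three (k + 1)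
    simp only [add_assoc, Nat.reduceAdd] at *
    rw [h3, h1, h2, h5, h4]
    ring

/-- The constant `V` cancels, leaving each value as the mean of the values five places before and
two places after it. This is what drives the minimum principle. -/
theorem two_mul_recSeq (a V : ℤ) (k : ℕ) :
    2 * recSeq a V (k + 5) = recSeq a V k + recSeq a V (k + 7) := by
  have h0 := recSeq_add_three a V k
  have h2 := recSeq_add_three a V (k + 2)
  have h3 := recSeq_add_three a V (k + 3)
  have h4 := recSeq_add_three a V (k + 4)
  simp only [add_assoc, Nat.reduceAdd] at *
  linarith

/-- The minimum principle for `recSeq`. -/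
theorem recSeq_nonneg {a V : ℤ} (ha : 0 ≤ a) (haV : a ≤ V) {n : ℕ} (hn : recSeq a V (n + 4) = 0)
    {k : ℕ} (hk : k ≤ n + 4) : 0 ≤ recSeq a V k := by
  have r0 : recSeq a V 0 = a := rfl
  have r1 : recSeq a V 1 = V := rfl
  have r2 : recSeq a V 2 = V - a := rfl
  have r3 : recSeq a V 3 = 0 := by rw [recSeq_add_three]; simp [recSeq]
  have r4 : recSeq a V 4 = 0 := by rw [recSeq_add_three, r3, r1]; ring
  -- At the first index where the maximum is attained, the mean value relation would force it
  -- already five places earlier. So the maximum occurs among the first five indices or the last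
  -- two.
  have key : ∀ (s t : ℤ), (∀ i, i ≤ 4 → s * recSeq a V i ≤ t) → 0 ≤ t →
      s * recSeq a V (n + 3) ≤ t → ∀ i, i ≤ n + 4 → s * recSeq a V i ≤ t := by
    intro s t h1 ht h2
    by_contra! hcon
    obtain ⟨i, hi, hit⟩ := hcon
    obtain ⟨j, hj, hjmax⟩ := Finset.exists_max_image (Finset.range (n + 5))
      (fun i => s * recSeq a V i) ⟨0, by simp⟩
    have hM := hjmax i (Finset.mem_range.2 (by omega))
    have hex : ∃ l, l ≤ n + 4 ∧ s * recSeq a V l = s * recSeq a V j :=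
      ⟨j, by have := Finset.mem_range.1 hj; omega, rfl⟩
    classical
    obtain ⟨hl, hle⟩ := Nat.find_spec hex
    have hmin := fun l (h : l < Nat.find hex) => Nat.find_min hex h
    set l := Nat.find hex
    have hl4 : 4 < l := by
      by_contra hc
      have := h1 l (by omega)
      linarith
    have hl3 : l ≠ n + 3 := by
      intro h
      rw [h] at hle
      linarith
    have hl5 : l ≠ n + 4 := by
      intro h
      rw [h, hn] at hle
      linarith
    obtain ⟨q, hq⟩ : ∃ q, l = q + 5 := ⟨l - 5, by omega⟩
    have e := two_mul_recSeq a V q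
    have a1 := hjmax q (Finset.mem_range.2 (by omega))
    have a2 := hjmax (q + 7) (Finset.mem_range.2 (by omega))
    have a3 : s * recSeq a V q ≠ s * recSeq a V j := fun h =>
      hmin q (by omega) ⟨by omega, h⟩
    have a4 := lt_of_le_of_ne a1 a3
    rw [hq] at hle
    have : s * (2 * recSeq a V (q + 5)) = s * (recSeq a V q + recSeq a V (q + 7)) := by rw [e]
    linarith
  -- The end condition gives `u (n + 3) = V - u (n + 1)`; were this negative, the maximum principle
  -- would give `u (n + 1) ≤ V`, a contradiction.
  have h3 : 0 ≤ recSeq a V (n + 3) := by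
    by_contra! hneg
    have e := recSeq_add_three a V (n + 1)
    simp only [add_assoc, Nat.reduceAdd] at e
    have := key 1 V (fun i hi => by interval_cases i <;> simp only [r0, r1, r2, r3, r4] <;> linarith)
      (by linarith) (by linarith) (n + 1) (by omega)
    linarith
  have := key (-1) 0 (fun i hi => by interval_cases i <;> simp only [r0, r1, r2, r3, r4] <;> linarith)
      le_rfl (by linarith) k hk
  linarith

/-! ### Columns of `beta` in reversed coordinates -/

theorem beta_apply (m : ℕ) (i j : Fin (m + 1)) :
    beta (m + 1) i j = if ((i : ℕ) = m ∧ (j : ℕ) = 0) ∨ ((i : ℕ) < m ∧ ((j : ℕ) = i + 1 ∨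
      (j : ℕ) = i + 2 ∨ ((i : ℕ) = j + 1 ∧ 1 ≤ (j : ℕ)))) then 1 else 0 := by
  rw [beta]
  induction i using Fin.lastCases with
  | last =>
    cases j using Fin.cases with
    | zero => simp
    | succ j => simp
  | cast i =>
    have hi : (i : ℕ) < m := i.2
    cases j using Fin.cases with
    | zero => simp [hi.ne]
    | succ j =>
      simp only [Matrix.of_apply, Fin.snoc_castSucc, Fin.cons_succ, bandMatrix, Fin.val_castSucc,
        Fin.val_succ]
      refine if_congr ?_ rfl rfl
      omega

theorem isBinary_beta (n : ℕ) : IsBinary (beta n) := by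
  cases n with
  | zero => exact fun i => i.elim0
  | succ m =>
    intro i j
    rw [beta_apply]
    split_ifs <;> simp

theorem beta_rev (m : ℕ) (i j : Fin (m + 1)) :
    beta (m + 1) i.rev j = beta (m + 1) j.rev i := by
  rw [beta_apply, beta_apply]
  refine if_congr ?_ rfl rfl
  simp only [Fin.val_rev]
  have := i.2
  have := j.2
  omega

section Columns

variable {R : Type*} [CommRing R] {m : ℕ}

/-- The reversal of `x` without its last coordinate, preceded by two zeros and followed by
zeros. -/
def revExtend (x : Fin (m + 1) → R) (t : ℕ) : R :=
  ∑ i : Fin (m + 1), if (i : ℕ) + t = m + 1 ∧ 2 ≤ t then x i else 0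

theorem revExtend_of_lt (x : Fin (m + 1) → R) {t : ℕ} (ht : t < 2) : revExtend x t = 0 :=
  Finset.sum_eq_zero fun i _ => if_neg (by omega)

theorem revExtend_of_gt (x : Fin (m + 1) → R) {t : ℕ} (ht : m + 2 ≤ t) : revExtend x t = 0 :=
  Finset.sum_eq_zero fun i _ => if_neg (by omega)

theorem revExtend_eq (x : Fin (m + 1) → R) (i : Fin (m + 1)) {t : ℕ} (hi : (i : ℕ) + t = m + 1)
    (ht : 2 ≤ t) : revExtend x t = x i := by
  rw [revExtend, Finset.sum_eq_single i]
  · exact if_pos ⟨hi, ht⟩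
  · intro j _ hj
    refine if_neg fun h => hj (Fin.ext ?_)
    omega
  · simp

theorem vecMul_beta_zero (x : Fin (m + 1) → R) :
    ∑ i, x i * (beta (m + 1) i 0 : R) = x (Fin.last m) := by
  rw [Finset.sum_eq_single (Fin.last m)]
  · simp [beta_apply]
  · intro i _ hi
    have : (i : ℕ) ≠ m := fun h => hi (Fin.ext h)
    simp [beta_apply, this]
  · simp

theorem vecMul_beta (x : Fin (m + 1) → R) {k : ℕ} (j : Fin (m + 1)) (hk : k < m)
    (hj : (j : ℕ) + k = m) :
    ∑ i, x i * (beta (m + 1) i j : R)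
      = revExtend x k + revExtend x (k + 2) + revExtend x (k + 3) := by
  simp only [revExtend, ← Finset.sum_add_distrib]
  refine Finset.sum_congr rfl fun i _ => ?_
  rw [beta_apply]
  split_ifs <;> first | omega | simp

end Columns

theorem forall_pos_of_vecMul_beta {m : ℕ} (hm2 : m ≠ 2) (hm5 : m ≠ 5) (hm6 : m ≠ 6)
    {x : Fin (m + 1) → ℝ} (hx : ∀ i, 0 ≤ x i) (hne : ∃ i, 0 < x i) {V : ℝ}
    (hle : ∀ j, (x ᵥ* (beta (m + 1)).map (Int.cast : ℤ → ℝ)) j ≤ V)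
    (heq : ∀ j, 0 < x j → (x ᵥ* (beta (m + 1)).map (Int.cast : ℤ → ℝ)) j = V) (j : Fin (m + 1)) :
    0 < x j := by
  have hmul : ∀ j, (x ᵥ* (beta (m + 1)).map (Int.cast : ℤ → ℝ)) j
      = ∑ i, x i * (beta (m + 1) i j : ℝ) := fun j => rfl
  simp only [hmul] at hle heq
  rcases Nat.eq_zero_or_pos m with rfl | hm
  · obtain ⟨i, hi⟩ := hne
    rwa [show j = i from Fin.ext (by omega)]
  have c0 := vecMul_beta_zero x
  have c := fun k (hk : k < m) => vecMul_beta x ⟨m - k, by omega⟩ hk (Nat.sub_add_cancel hk.le)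
  have hp : ∀ t, 0 ≤ revExtend x t := by
    intro t
    refine Finset.sum_nonneg fun i _ => ?_
    split_ifs
    · exact hx i
    · exact le_rfl
  have hval : ∀ t : ℕ, ∀ _ : 2 ≤ t, t ≤ m + 1 → revExtend x t = x ⟨m + 1 - t, by omega⟩ :=
    fun t ht _ => revExtend_eq x ⟨m + 1 - t, by omega⟩ (by simp; omega) ht
  have hle' : ∀ k, k < m → revExtend x k + revExtend x (k + 2) + revExtend x (k + 3) ≤ V :=
    fun k hk => (c k hk) ▸ hle _
  have hne' : 0 < x (Fin.last m) ∨ ∃ t, 0 < revExtend x t := by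
    obtain ⟨i, hi⟩ := hne
    by_cases him : (i : ℕ) = m
    · rw [show i = Fin.last m from Fin.ext him] at hi
      exact Or.inl hi
    · refine Or.inr ⟨m + 1 - i, ?_⟩
      rwa [revExtend_eq x i (by omega) (by omega)]
  have hV : 0 < V := by
    rcases hne' with h | ⟨t, ht⟩
    · exact h.trans_le (c0 ▸ hle 0)
    · have h2 : 2 ≤ t := by
        by_contra hc
        rw [revExtend_of_lt x (by omega)] at ht
        exact lt_irrefl _ ht
      have h3 : t < m + 2 := by
        by_contra hc
        rw [revExtend_of_gt x (by omega)] at ht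
        exact lt_irrefl _ ht
      have h4 := hle' (t - 2) (by omega)
      rw [show t - 2 + 2 = t by omega] at h4
      linarith [hp (t - 2), hp (t - 2 + 3)]
  obtain ⟨h1, h2⟩ := support_eq_univ hm2 hm5 hm6 hm hV hp (revExtend_of_lt x (by omega))
    (revExtend_of_lt x (by omega)) (fun t ht => revExtend_of_gt x ht) hle'
    (fun k hk hk1 => by
      rw [← c k hk]
      rcases Nat.eq_zero_or_pos k with rfl | hk0
      · rw [revExtend_of_lt x (by omega)] at hk1
        exact absurd hk1 (lt_irrefl _)
      · rw [hval _ (by omega) (by omega)] at hk1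
        have e : (⟨m + 1 - (k + 1), by omega⟩ : Fin (m + 1)) = ⟨m - k, by omega⟩ :=
          Fin.ext (by simp)
        rw [e] at hk1
        exact heq _ hk1)
    (fun hw => by
      have := c 0 hm
      rw [revExtend_of_lt x (by omega), zero_add] at this
      rw [← this]
      exact heq _ hw)
    (fun hm1 => by
      rw [hval _ (by omega) le_rfl] at hm1
      rw [← c0]
      refine heq 0 ?_
      convert hm1
      simp)
    hne'
  by_cases hj : (j : ℕ) = m
  · rwa [show j = Fin.last m from Fin.ext hj]
  · have := h2 (m + 1 - j) (by omega) (by omega)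
    rwa [revExtend_eq x j (by omega) (by omega)] at this

/-! ### The determinant and the integral equalizer -/

/-- The reversal of `recSeq`, with a modified last coordinate. -/
def recVec (a V : ℤ) (m : ℕ) (i : Fin (m + 1)) : ℤ :=
  if (i : ℕ) = m then V else recSeq a V (m - i + 4)

theorem recSeq_three (a V : ℤ) : recSeq a V 3 = 0 := by
  rw [recSeq_add_three]
  simp [recSeq]

theorem recSeq_four (a V : ℤ) : recSeq a V 4 = 0 := by
  rw [recSeq_add_three, recSeq_three]
  simp [recSeq]

theorem revExtend_recVec {a V : ℤ} {m t : ℕ} (ht : t ≤ m + 1) :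
    revExtend (recVec a V m) t = recSeq a V (t + 3) := by
  match t, ht with
  | 0, _ => rw [revExtend_of_lt _ (by omega), recSeq_three]
  | 1, _ => rw [revExtend_of_lt _ (by omega), recSeq_four]
  | t + 2, ht =>
    rw [revExtend_eq _ ⟨m + 1 - (t + 2), by omega⟩ (by simp; omega) (by omega), recVec,
      if_neg (by simp; omega)]
    congr 1
    simp
    omega

/-- Every column is equalized except column `1`, where the recurrence would need one term beyond the
end of the vector; the defect is that missing term. -/
theorem recVec_vecMul_beta (a V : ℤ) (m : ℕ) (j : Fin (m + 1)) :
    ∑ i, recVec a V m i * beta (m + 1) i j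
      = V - if (j : ℕ) = 1 then recSeq a V (m + 5) else 0 := by
  by_cases hj : j = 0
  · have := vecMul_beta_zero (recVec a V m)
    simp only [Int.cast_id] at this
    subst hj
    rw [this]
    simp [recVec]
  · have hj' : (j : ℕ) ≠ 0 := fun h => hj (Fin.ext h)
    have := vecMul_beta (recVec a V m) (k := m - j) j (by omega) (by omega)
    simp only [Int.cast_id] at this
    have h3 := recSeq_add_three a V (m - j + 3)
    rw [this, revExtend_recVec (by omega), revExtend_recVec (by omega)]
    split_ifs with h1
    · rw [revExtend_of_gt _ (by omega)]
      rw [show m - (j : ℕ) + 3 + 3 = m + 5 by omega] at h3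
      rw [h3]
      ring
    · rw [revExtend_recVec (by omega)]
      simp only [add_assoc, Nat.reduceAdd] at h3 ⊢
      linarith

/-- Taking `V = 0`, `a = 1` gives a combination of rows that vanishes outside column `1`. It
replaces row `m - 1`, whose coefficient is `1`, without changing the determinant, and a row
permutation makes the result triangular. -/
theorem abs_det_beta (m : ℕ) : |(beta (m + 1)).det| = diffSeq (m + 1) := by
  rcases Nat.eq_zero_or_pos m with rfl | hm
  · simp [beta_apply, diffSeq, absSeq, bSeq]
  let r : Fin (m + 1) := ⟨m - 1, by omega⟩
  set s := recSeq 1 0 (m + 5) with hs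
  have h1 := Matrix.det_updateRow_sum (beta (m + 1)) r (recVec 1 0 m)
  have hr : recVec 1 0 m r = 1 := by
    rw [recVec, if_neg (by simp [r]; omega), show m - (r : ℕ) + 4 = 1 + 4 by simp [r]; omega,
      recSeq_eq]
    simp [bSeq]
  have hrow : (∑ k, recVec 1 0 m k • beta (m + 1) k)
      = fun j : Fin (m + 1) => if (j : ℕ) = 1 then -s else 0 := by
    ext j
    have := recVec_vecMul_beta 1 0 m j
    simp only [Finset.sum_apply, Pi.smul_apply, smul_eq_mul]
    rw [this]
    split_ifs <;> simp [hs]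
  rw [hr, one_smul, hrow] at h1
  rw [← h1]
  set M := (beta (m + 1)).updateRow r (fun j => if (j : ℕ) = 1 then -s else 0) with hM
  -- The last row comes first, then the replaced row `m - 1`, then the others in order: row `i - 2`
  -- has its rightmost one in column `i`.
  let f : Fin (m + 1) → Fin (m + 1) := fun i =>
    ⟨if 2 ≤ (i : ℕ) then i - 2 else m - i, by have := i.2; split_ifs <;> omega⟩
  have hf : Function.Injective f := by
    intro i j hij
    have h := congrArg Fin.val hij
    have := i.2
    have := j.2
    simp only [f] at h
    refine Fin.ext ?_
    split_ifs at h <;> omega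
  let σ : Fin (m + 1) ≃ Fin (m + 1) := Equiv.ofBijective f (Finite.injective_iff_bijective.1 hf)
  have hσ : ∀ i, ((σ i : Fin (m + 1)) : ℕ) = if 2 ≤ (i : ℕ) then (i : ℕ) - 2 else m - i :=
    fun i => rfl
  have hσr : ∀ i, σ i = r ↔ (i : ℕ) = 1 := by
    intro i
    have := i.2
    rw [Fin.ext_iff, hσ]
    simp only [r]
    split_ifs <;> omega
  rw [← Matrix.abs_det_submatrix_equiv_equiv σ (Equiv.refl _) M]
  have hval : ∀ i j, M.submatrix σ (Equiv.refl _) i j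
      = if (i : ℕ) = 1 then (if (j : ℕ) = 1 then -s else 0) else beta (m + 1) (σ i) j := by
    intro i j
    rw [Matrix.submatrix_apply, hM, Matrix.updateRow_apply]
    simp only [hσr, Equiv.refl_apply]
    split_ifs with h1 h2
    · exact if_pos h2
    · exact if_neg h2
    · rfl
  rw [Matrix.det_of_isLowerTriangular]
  · rw [Finset.prod_eq_single (⟨1, by omega⟩ : Fin (m + 1))]
    · rw [hval]
      simp only [if_true]
      rw [hs, recSeq_eq, zero_mul, add_zero, one_mul, abs_neg]
      rw [← abs_of_nonneg (diffSeq_nonneg (m + 1)), diffSeq_eq, abs_mul, abs_pow, abs_neg,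
        abs_one, one_pow, one_mul]
    · intro i _ hi
      have hi1 : (i : ℕ) ≠ 1 := fun h => hi (Fin.ext h)
      rw [hval, if_neg hi1, beta_apply, if_pos]
      have := i.2
      rw [hσ]
      split_ifs <;> omega
    · simp
  · intro i j hij
    have hij' : (i : ℕ) < j := hij
    rw [hval]
    split_ifs with h1 h2
    · omega
    · rfl
    · rw [beta_apply, if_neg]
      have := j.2
      rw [hσ]
      split_ifs <;> omega

theorem det_beta_ne_zero (m : ℕ) : (beta (m + 1)).det ≠ 0 := by
  rw [← abs_ne_zero, abs_det_beta]
  exact (diffSeq_pos m).ne'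

/-- The integral equalizing vector of `beta (m + 1)`. -/
def equalizer (m : ℕ) : Fin (m + 1) → ℤ :=
  recVec (absSeq (m + 1)) (diffSeq (m + 1)) m

theorem recSeq_absSeq_diffSeq (n : ℕ) : recSeq (absSeq n) (diffSeq n) (n + 4) = 0 := by
  rw [recSeq_eq, diffSeq_eq, absSeq]
  ring

theorem recSeq_absSeq_nonneg {n k : ℕ} (hk : k ≤ n + 4) :
    0 ≤ recSeq (absSeq n) (diffSeq n) k :=
  recSeq_nonneg (absSeq_nonneg n) (le_add_of_nonneg_right (absSeq_nonneg _))
    (recSeq_absSeq_diffSeq n) hk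

theorem equalizer_nonneg (m : ℕ) (i : Fin (m + 1)) : 0 ≤ equalizer m i := by
  rw [equalizer, recVec]
  split_ifs
  · exact diffSeq_nonneg _
  · exact recSeq_absSeq_nonneg (by omega)

theorem equalizer_le (m : ℕ) (i : Fin (m + 1)) : equalizer m i ≤ diffSeq (m + 1) := by
  rw [equalizer, recVec]
  split_ifs with h
  · exact le_rfl
  · have e := recSeq_add_three (absSeq (m + 1)) (diffSeq (m + 1)) (m - i + 2)
    have h1 := recSeq_absSeq_nonneg (n := m + 1) (k := m - i + 2) (by omega)
    have h2 := recSeq_absSeq_nonneg (n := m + 1) (k := m - i + 2 + 3) (by omega)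
    simp only [add_assoc, Nat.reduceAdd] at *
    linarith

theorem equalizer_last (m : ℕ) : equalizer m (Fin.last m) = diffSeq (m + 1) := by
  simp [equalizer, recVec]

theorem equalizer_vecMul_beta (m : ℕ) (j : Fin (m + 1)) :
    ∑ i, equalizer m i * beta (m + 1) i j = diffSeq (m + 1) := by
  rw [equalizer, recVec_vecMul_beta, recSeq_absSeq_diffSeq]
  simp

theorem diffSeq_le_sum_equalizer (m : ℕ) : diffSeq (m + 1) ≤ ∑ i, equalizer m i := by
  rw [← equalizer_last]
  exact Finset.single_le_sum (fun i _ => equalizer_nonneg m i) (Finset.mem_univ _)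

theorem sum_equalizer_le (m : ℕ) : ∑ i, equalizer m i ≤ (m + 1) * diffSeq (m + 1) := by
  have := Finset.sum_le_card_nsmul Finset.univ _ _ fun i _ => equalizer_le m i
  simpa using this

/-- Multiplying the equalizing equation by the adjugate expresses `det • equalizer` through the
cofactors; the common value `diffSeq (m + 1)` equals `|det|` and cancels. -/
theorem sum_equalizer_eq (m : ℕ) : ∑ i, equalizer m i = |cofactorSum (beta (m + 1))| := by
  have h1 : equalizer m ᵥ* beta (m + 1) = fun _ => diffSeq (m + 1) :=
    funext (equalizer_vecMul_beta m)
  have h2 : equalizer m ᵥ* (beta (m + 1) * (beta (m + 1)).adjugate)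
      = (fun _ => diffSeq (m + 1)) ᵥ* (beta (m + 1)).adjugate := by
    rw [← Matrix.vecMul_vecMul, h1]
  rw [Matrix.mul_adjugate, Matrix.vecMul_smul, Matrix.vecMul_one] at h2
  have h3 : (beta (m + 1)).det * ∑ i, equalizer m i
      = diffSeq (m + 1) * cofactorSum (beta (m + 1)) := by
    have hc : cofactorSum (beta (m + 1)) = ∑ j, ∑ i, (beta (m + 1)).adjugate i j :=
      Finset.sum_comm
    rw [hc, Finset.mul_sum, Finset.mul_sum]
    refine Finset.sum_congr rfl fun j _ => ?_
    have := congrFun h2 j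
    rw [Pi.smul_apply, smul_eq_mul] at this
    rw [this, Matrix.vecMul, dotProduct, Finset.mul_sum]
  have h4 := congrArg abs h3
  rw [abs_mul, abs_mul, abs_det_beta, abs_of_nonneg (diffSeq_nonneg _),
    abs_of_nonneg ((diffSeq_nonneg _).trans (diffSeq_le_sum_equalizer m))] at h4
  exact mul_left_cancel₀ (diffSeq_pos m).ne' h4

theorem dvd_recSeq {a V d : ℤ} (ha : d ∣ a) (hV : d ∣ V) (k : ℕ) : d ∣ recSeq a V k := by
  induction k using Nat.strong_induction_on with
  | _ k ih =>
  match k, ih with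
  | 0, _ => exact ha
  | 1, _ => exact hV
  | 2, _ => exact dvd_sub hV ha
  | k + 3, ih => exact dvd_sub (dvd_sub hV (ih _ (by omega))) (ih _ (by omega))

theorem dvd_absSeq {d : ℤ} {n : ℕ} : d ∣ absSeq n ↔ d ∣ bSeq n := by
  rw [absSeq_eq_abs, dvd_abs]

/-- The last coordinate is `V`, the one before it is `a`, and all others are integral combinations
of these two, with `V - a = absSeq (m + 2)`. -/
theorem gcd_equalizer (m : ℕ) : (Finset.univ.gcd fun i => (equalizer m i).natAbs)
    = Int.gcd (bSeq (m + 1)) (bSeq (m + 2)) := by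
  apply Nat.dvd_antisymm
  · set g := Finset.univ.gcd fun i => (equalizer m i).natAbs with hg
    have hdvd : ∀ i, (g : ℤ) ∣ equalizer m i := fun i =>
      Int.natCast_dvd.2 (Finset.gcd_dvd (Finset.mem_univ i))
    have hV := hdvd (Fin.last m)
    rw [equalizer_last] at hV
    have ha : (g : ℤ) ∣ absSeq (m + 1) := by
      rcases Nat.eq_zero_or_pos m with rfl | hm
      · simp [absSeq, bSeq]
      · have := hdvd ⟨m - 1, by omega⟩
        rw [equalizer, recVec, if_neg (by simp; omega)] at this
        rw [show m - ((⟨m - 1, by omega⟩ : Fin (m + 1)) : ℕ) + 4 = 1 + 4 by simp; omega,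
          recSeq_eq] at this
        simpa [bSeq] using this
    have hb : (g : ℤ) ∣ absSeq (m + 2) := (dvd_add_right ha).1 hV
    exact Int.dvd_gcd (dvd_absSeq.1 ha) (dvd_absSeq.1 hb)
  · refine Finset.dvd_gcd fun i _ => ?_
    rw [← Int.natCast_dvd]
    have h1 := dvd_absSeq.2 (Int.gcd_dvd_left (bSeq (m + 1)) (bSeq (m + 2)))
    have h2 := dvd_absSeq.2 (Int.gcd_dvd_right (bSeq (m + 1)) (bSeq (m + 2)))
    rw [equalizer, recVec]
    split_ifs
    · exact dvd_add h1 h2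
    · exact dvd_recSeq h1 (dvd_add h1 h2) _

theorem gcd_bSeq_pos (m : ℕ) : 0 < Int.gcd (bSeq (m + 1)) (bSeq (m + 2)) := by
  refine Nat.pos_of_ne_zero fun h => ?_
  obtain ⟨h1, h2⟩ := Int.gcd_eq_zero_iff.1 h
  have := diffSeq_pos m
  rw [diffSeq_eq, h1, h2] at this
  simp at this

/-- The quotient of `|K(βₙ)|` by `gcd(bₙ, bₙ₊₁)`. -/
def betaComplexity (n : ℕ) : ℕ :=
  (cofactorSum (beta n)).natAbs / Int.gcd (bSeq n) (bSeq (n + 1))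

theorem sum_natAbs_equalizer (m : ℕ) :
    ∑ i, (equalizer m i).natAbs = (cofactorSum (beta (m + 1))).natAbs := by
  zify
  rw [← sum_equalizer_eq]
  exact Finset.sum_congr rfl fun i _ => abs_of_nonneg (equalizer_nonneg m i)

theorem gcd_bSeq_dvd_cofactorSum (m : ℕ) :
    Int.gcd (bSeq (m + 1)) (bSeq (m + 2)) ∣ (cofactorSum (beta (m + 1))).natAbs := by
  rw [← sum_natAbs_equalizer, ← gcd_equalizer]
  exact Finset.dvd_sum fun i hi => Finset.gcd_dvd hi

theorem complexity_equalizer (m : ℕ) :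
    complexity (fun i => (equalizer m i : ℝ) / ((∑ j, equalizer m j : ℤ) : ℝ))
      = (betaComplexity (m + 1) : ℕ∞) := by
  have h := complexity_div_sum (X := fun i => (equalizer m i).natAbs) (by
    have := (diffSeq_pos m).trans_le (diffSeq_le_sum_equalizer m)
    rw [sum_equalizer_eq] at this
    rw [sum_natAbs_equalizer]
    exact Int.natAbs_pos.2 (abs_pos.1 this))
  rw [gcd_equalizer, sum_natAbs_equalizer] at h
  rw [betaComplexity, ← h]
  congr 1
  ext i
  rw [sum_equalizer_eq, Nat.cast_natAbs, Nat.cast_natAbs, abs_of_nonneg (equalizer_nonneg m i)]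

theorem complexity_comp_rev {n : ℕ} (x : Fin n → ℝ) : complexity (x ∘ Fin.rev) = complexity x := by
  have key : ∀ x : Fin n → ℝ, complexity (x ∘ Fin.rev) ≤ complexity x := by
    intro x
    refine le_sInf ?_
    rintro c ⟨p, q, rfl, hq, hp, hx⟩
    refine (complexity_eq (p := p ∘ Fin.rev) hq ?_ fun i => hx _).le
    rw [← hp]
    refine Nat.dvd_antisymm (Finset.dvd_gcd fun i _ => ?_) (Finset.dvd_gcd fun i _ =>
      Finset.gcd_dvd (Finset.mem_univ _))
    have := Finset.gcd_dvd (f := p ∘ Fin.rev) (Finset.mem_univ i.rev)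
    simpa using this
  refine le_antisymm (key x) ?_
  have := key (x ∘ Fin.rev)
  rwa [show (x ∘ Fin.rev) ∘ Fin.rev = x by ext; simp] at this

theorem exists_equilibria_beta {m : ℕ} (hm2 : m ≠ 2) (hm5 : m ≠ 5) (hm6 : m ≠ 6) :
    ∃ x y : Fin (m + 1) → ℝ,
      nashEquilibria 1 (beta (m + 1)) = {(x, fun _ => ((m + 1 : ℕ) : ℝ)⁻¹)} ∧
      nashEquilibria (ones (m + 1) - beta (m + 1)) (beta (m + 1)) = {(x, y)} ∧
      (∀ i, 0 < x i) ∧ complexity x = (betaComplexity (m + 1) : ℕ∞) ∧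
      complexity y = (betaComplexity (m + 1) : ℕ∞) := by
  set S : ℤ := ∑ j, equalizer m j with hS
  have hS0 : 0 < S := (diffSeq_pos m).trans_le (diffSeq_le_sum_equalizer m)
  have hS0' : (0 : ℝ) < S := by exact_mod_cast hS0
  set x : Fin (m + 1) → ℝ := fun i => (equalizer m i : ℝ) / (S : ℝ) with hx
  have hx0 : ∀ i, 0 ≤ x i := fun i =>
    div_nonneg (by exact_mod_cast equalizer_nonneg m i) hS0'.le
  have hsum : ∑ i, x i = 1 := by
    simp only [hx, ← Finset.sum_div]
    rw [div_eq_one_iff_eq hS0'.ne', hS]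
    push_cast
    rfl
  have hxs : x ∈ stdSimplex ℝ (Fin (m + 1)) := ⟨hx0, hsum⟩
  set v : ℝ := (diffSeq (m + 1) : ℝ) / S with hv
  have hxB' : ∀ j, ∑ i, x i * (beta (m + 1) i j : ℝ) = v := by
    intro j
    rw [hv, ← equalizer_vecMul_beta m j]
    push_cast
    rw [Finset.sum_div]
    exact Finset.sum_congr rfl fun i _ => by ring
  have hxB : x ᵥ* (beta (m + 1)).map (Int.cast : ℤ → ℝ) = fun _ => v :=
    funext fun j => hxB' j
  have hBy : (beta (m + 1)).map (Int.cast : ℤ → ℝ) *ᵥ (x ∘ Fin.rev) = fun _ => v := by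
    ext i
    rw [← hxB' i.rev]
    change ∑ j, (beta (m + 1) i j : ℝ) * x j.rev = _
    refine Fintype.sum_equiv Fin.revPerm _ _ fun j => ?_
    rw [Fin.revPerm_apply, beta_rev, Fin.rev_rev, mul_comm]
  have hpos : ∀ i, 0 < x i :=
    forall_pos_of_vecMul_beta hm2 hm5 hm6 hx0 (exists_pos_of_mem_stdSimplex hxs) (V := v)
      (fun j => (congrFun hxB j).le) fun j _ => congrFun hxB j
  have hys : x ∘ Fin.rev ∈ stdSimplex ℝ (Fin (m + 1)) :=
    ⟨fun i => hx0 _, by rw [← hsum]; exact Fintype.sum_equiv Fin.revPerm _ _ fun j => rfl⟩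
  exact ⟨x, x ∘ Fin.rev,
    nashEquilibria_one (det_beta_ne_zero m) hxs hxB fun x' hx' V h1 h2 =>
      forall_pos_of_vecMul_beta hm2 hm5 hm6 hx'.1 (exists_pos_of_mem_stdSimplex hx') h1 h2,
    nashEquilibria_ones_sub (det_beta_ne_zero m) hxs hys hpos (fun i => hpos _) hxB hBy,
    hpos, complexity_equalizer m, (complexity_comp_rev x).trans (complexity_equalizer m)⟩

/-! ### Growth -/

theorem exists_cubic_root : ∃ r : ℝ, -3 / 2 ≤ r ∧ r ≤ -7 / 5 ∧ r ^ 3 + r ^ 2 + 1 = 0 := by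
  have h : ContinuousOn (fun r : ℝ => r ^ 3 + r ^ 2 + 1) (Set.Icc (-3 / 2) (-7 / 5)) := by
    fun_prop
  obtain ⟨r, hr, h0⟩ := intermediate_value_Icc (by norm_num) h
    (show (0 : ℝ) ∈ _ from ⟨by norm_num, by norm_num⟩)
  exact ⟨r, hr.1, hr.2, h0⟩

/-- Subtracting `r * bSeq n` removes the dominant root `r` of `x³ + x² + 1`; the other two are
complex conjugates with product `r * (r + 1) < 1`. -/
theorem exists_bound_linear_form {r : ℝ} (h1 : -3 / 2 ≤ r) (h2 : r ≤ -7 / 5)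
    (h : r ^ 3 + r ^ 2 + 1 = 0) : ∃ C : ℝ, ∀ n, |(bSeq (n + 1) : ℝ) - r * bSeq n| ≤ C := by
  have hden : 0 < r ^ 2 + 2 * r + 2 := by nlinarith
  -- This is the fixed point of the remaining affine recurrence of order two.
  set t : ℝ := (r ^ 2 + 2 * r + 2)⁻¹ with ht
  have htd : (r ^ 2 + 2 * r + 2) * t = 1 := mul_inv_cancel₀ hden.ne'
  set f : ℕ → ℝ := fun n => (bSeq (n + 1) : ℝ) - r * bSeq n - t with hf
  have hrec : ∀ n, f (n + 2) = -(r + 1) * f (n + 1) - r * (r + 1) * f n := by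
    intro n
    have e : (bSeq (n + 3) : ℝ) = 1 - bSeq (n + 2) - bSeq n := by
      exact_mod_cast bSeq_add_three n
    simp only [hf, add_assoc, Nat.reduceAdd]
    rw [e]
    linear_combination (-(bSeq n : ℝ)) * h - htd
  -- A positive definite quadratic form that each step of the recurrence multiplies by `r * (r +
  -- 1)`.
  set Q : ℕ → ℝ := fun n => f (n + 1) ^ 2 + (r + 1) * f n * f (n + 1) + r * (r + 1) * f n ^ 2
    with hQ
  have hQf : ∀ n, f n ^ 2 ≤ 4 * Q n := by
    intro n
    have : 0 ≤ (2 * f (n + 1) + (r + 1) * f n) ^ 2 := sq_nonneg _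
    have h3 : 0 ≤ (4 * (r * (r + 1)) - (r + 1) ^ 2 - 1) * f n ^ 2 :=
      mul_nonneg (by nlinarith) (sq_nonneg _)
    simp only [hQ]
    linarith
  have hQ0 : ∀ n, Q n ≤ Q 0 := by
    intro n
    induction n with
    | zero => exact le_rfl
    | succ n ih =>
      have e : Q (n + 1) = r * (r + 1) * Q n := by
        simp only [hQ, add_assoc, Nat.reduceAdd]
        rw [hrec]
        ring
      have h3 : 0 ≤ Q n := by linarith [hQf n, sq_nonneg (f n)]
      have h4 : r * (r + 1) ≤ 1 := by nlinarith
      rw [e]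
      exact (mul_le_of_le_one_left h3 h4).trans ih
  refine ⟨4 * Q 0 + 1 + |t|, fun n => ?_⟩
  have h3 : |f n| ≤ 4 * Q 0 + 1 := by
    have h4 := (hQf n).trans (mul_le_mul_of_nonneg_left (hQ0 n) (by norm_num))
    rw [← sq_abs] at h4
    nlinarith [sq_nonneg (|f n| - 1)]
  have h5 : (bSeq (n + 1) : ℝ) - r * bSeq n = f n + t := by simp [hf]
  rw [h5]
  exact (abs_add_le _ _).trans (by linarith)

/-- Modulo `2` the form vanishes only at `(0, 0)`, as `x³ + x² + 1` has no root there. -/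
theorem odd_cubic_form {u w : ℤ} (h : Int.gcd u w = 1) : Odd (u ^ 3 + u ^ 2 * w + w ^ 3) := by
  have h2 : ¬ (Even u ∧ Even w) := by
    rintro ⟨hu, hw⟩
    have := Int.dvd_gcd hu.two_dvd hw.two_dvd
    rw [h] at this
    norm_num at this
  rw [← Int.not_even_iff_odd]
  simp only [Int.even_add, Int.even_mul, Int.even_pow]
  tauto

theorem gcd_pow_three_le {u w : ℤ} (h : 0 < Int.gcd u w) :
    (Int.gcd u w : ℤ) ^ 3 ≤ |u ^ 3 + u ^ 2 * w + w ^ 3| := by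
  obtain ⟨u', w', hc, hu, hw⟩ := Int.exists_gcd_one h
  have hodd := odd_cubic_form hc
  have h1 : 1 ≤ |u' ^ 3 + u' ^ 2 * w' + w' ^ 3| := by
    refine Int.one_le_abs fun h0 => ?_
    rw [h0] at hodd
    exact absurd hodd (by decide)
  set d : ℤ := (Int.gcd u w : ℤ)
  have hd : 0 ≤ d := Int.natCast_nonneg _
  calc d ^ 3 ≤ d ^ 3 * |u' ^ 3 + u' ^ 2 * w' + w' ^ 3| :=
        le_mul_of_one_le_right (pow_nonneg hd 3) h1
    _ = |d ^ 3 * (u' ^ 3 + u' ^ 2 * w' + w' ^ 3)| := by rw [abs_mul, abs_of_nonneg (pow_nonneg hd 3)]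
    _ = |u ^ 3 + u ^ 2 * w + w ^ 3| := by
        congr 1
        rw [hu, hw]
        ring

theorem exists_gcd_bSeq_pow_three_le : ∃ C : ℝ, ∀ m : ℕ,
    (Int.gcd (bSeq (m + 1)) (bSeq (m + 2)) : ℝ) ^ 3 ≤ C * (diffSeq (m + 1) : ℝ) ^ 2 := by
  obtain ⟨r, h1, h2, h⟩ := exists_cubic_root
  obtain ⟨C, hC⟩ := exists_bound_linear_form h1 h2 h
  refine ⟨C, fun m => ?_⟩
  have hC0 : 0 ≤ C := (abs_nonneg _).trans (hC 0)
  have hg := gcd_pow_three_le (u := bSeq (m + 2)) (w := bSeq (m + 1))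
    (by rw [Int.gcd_comm]; exact gcd_bSeq_pos m)
  rw [Int.gcd_comm] at hg
  have hg' : (Int.gcd (bSeq (m + 1)) (bSeq (m + 2)) : ℝ) ^ 3 ≤
      |(bSeq (m + 2) : ℝ) ^ 3 + (bSeq (m + 2) : ℝ) ^ 2 * bSeq (m + 1) + (bSeq (m + 1) : ℝ) ^ 3| := by
    exact_mod_cast hg
  refine hg'.trans ?_
  have hs : (diffSeq (m + 1) : ℝ) = |(bSeq (m + 1) : ℝ)| + |(bSeq (m + 2) : ℝ)| := by
    rw [diffSeq, absSeq_eq_abs, absSeq_eq_abs]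
    push_cast
    rfl
  have hC1 := hC (m + 1)
  rw [hs]
  simp only [add_assoc, Nat.reduceAdd] at hC1
  set X := (bSeq (m + 2) : ℝ)
  set Y := (bSeq (m + 1) : ℝ)
  have e : X ^ 3 + X ^ 2 * Y + Y ^ 3
      = (X - r * Y) * (X ^ 2 + (r + 1) * X * Y + r * (r + 1) * Y ^ 2) := by
    linear_combination (Y ^ 3) * h
  rw [e, abs_mul]
  refine mul_le_mul hC1 ?_ (abs_nonneg _) hC0
  have hXY : |(r + 1) * X * Y| ≤ 2 * (|Y| * |X|) := by
    rw [mul_assoc, abs_mul, abs_mul, mul_comm |Y|]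
    exact mul_le_mul_of_nonneg_right (abs_le.2 ⟨by linarith, by linarith⟩) (by positivity)
  have hYY : |r * (r + 1) * Y ^ 2| ≤ Y ^ 2 := by
    rw [abs_mul, abs_of_nonneg (sq_nonneg Y)]
    exact mul_le_of_le_one_left (sq_nonneg Y) (abs_le.2 ⟨by nlinarith, by nlinarith⟩)
  calc |X ^ 2 + (r + 1) * X * Y + r * (r + 1) * Y ^ 2|
      ≤ |X ^ 2| + |(r + 1) * X * Y| + |r * (r + 1) * Y ^ 2| := abs_add_three _ _ _
    _ ≤ X ^ 2 + 2 * (|Y| * |X|) + Y ^ 2 := by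
        rw [abs_of_nonneg (sq_nonneg X)]
        linarith
    _ = (|Y| + |X|) ^ 2 := by
        rw [← sq_abs X, ← sq_abs Y]
        ring

theorem two_pow_le_diffSeq (n : ℕ) : 2 ^ (n + 1) ≤ 8 * diffSeq (n + 1) ^ 3 := by
  induction n using Nat.strong_induction_on with
  | _ n ih =>
  match n, ih with
  | 0, _ => simp [diffSeq, absSeq, bSeq]
  | 1, _ => simp [diffSeq, absSeq, bSeq]
  | 2, _ => simp [diffSeq, absSeq, bSeq]
  | n + 3, ih =>
    have h1 := ih n (by omega)
    have h2 : 2 * diffSeq (n + 1) ≤ diffSeq (n + 3 + 1) := by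
      have h3 := diffSeq_add_three (n + 1)
      have h4 := diffSeq_mono (show n + 1 ≤ n + 1 + 2 by omega)
      rw [show n + 3 + 1 = n + 1 + 3 by ring]
      linarith
    have h5 := pow_le_pow_left₀ (mul_nonneg zero_le_two (diffSeq_nonneg _)) h2 3
    rw [mul_pow] at h5
    calc (2 : ℤ) ^ (n + 3 + 1) = 8 * 2 ^ (n + 1) := by ring
      _ ≤ 8 * diffSeq (n + 3 + 1) ^ 3 := by linarith

theorem diffSeq_le_two_pow (n : ℕ) : diffSeq n ≤ 2 ^ n := by
  induction n using Nat.strong_induction_on with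
  | _ n ih =>
  match n, ih with
  | 0, _ => simp [diffSeq, absSeq, bSeq]
  | 1, _ => simp [diffSeq, absSeq, bSeq]
  | 2, _ => simp [diffSeq, absSeq, bSeq]
  | n + 3, ih =>
    have h1 := ih n (by omega)
    have h2 := ih (n + 2) (by omega)
    rw [diffSeq_add_three]
    have : (0 : ℤ) < 2 ^ n := by positivity
    simp only [pow_add] at h2 ⊢
    linarith

theorem betaComplexity_mul_gcd (m : ℕ) :
    (betaComplexity (m + 1) : ℝ) * Int.gcd (bSeq (m + 1)) (bSeq (m + 2))
      = ((∑ i, equalizer m i : ℤ) : ℝ) := by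
  have h := Nat.div_mul_cancel (gcd_bSeq_dvd_cofactorSum m)
  rw [sum_equalizer_eq, ← Nat.cast_natAbs]
  exact_mod_cast h

theorem betaComplexity_le (m : ℕ) : (betaComplexity (m + 1) : ℝ) ≤ 4 ^ (m + 1) := by
  have h1 : (1 : ℝ) ≤ Int.gcd (bSeq (m + 1)) (bSeq (m + 2)) := by exact_mod_cast gcd_bSeq_pos m
  have h2 := le_mul_of_one_le_right (Nat.cast_nonneg (betaComplexity (m + 1))) h1
  rw [betaComplexity_mul_gcd] at h2
  refine h2.trans ?_
  have h3 : ((m : ℤ) + 1) ≤ 2 ^ (m + 1) := by exact_mod_cast (Nat.lt_two_pow_self (n := m + 1)).le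
  have h4 : ∑ i, equalizer m i ≤ 4 ^ (m + 1) :=
    calc ∑ i, equalizer m i ≤ (m + 1) * diffSeq (m + 1) := sum_equalizer_le m
      _ ≤ 2 ^ (m + 1) * 2 ^ (m + 1) :=
          mul_le_mul h3 (diffSeq_le_two_pow _) (diffSeq_nonneg _) (by positivity)
      _ = 4 ^ (m + 1) := by rw [← mul_pow]; norm_num
  exact_mod_cast h4

/-- With `s = diffSeq`, `F` the complexity and `d` the gcd, `s ≤ F * d` and `d³ ≤ C * s²` give `s ≤
C * F³`; the exponent `9` comes from `2ⁿ ≤ 8 * s³`. -/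
theorem exists_le_betaComplexity : ∃ C : ℝ, 0 < C ∧ ∀ m : ℕ,
    (2 : ℝ) ^ (m + 1) ≤ C * (betaComplexity (m + 1) : ℝ) ^ 9 := by
  obtain ⟨C, hC⟩ := exists_gcd_bSeq_pow_three_le
  have hs : ∀ m : ℕ, (0 : ℝ) < diffSeq (m + 1) := fun m => by exact_mod_cast diffSeq_pos m
  have hd : ∀ m : ℕ, (0 : ℝ) < Int.gcd (bSeq (m + 1)) (bSeq (m + 2)) := fun m => by
    exact_mod_cast gcd_bSeq_pos m
  have hC0 : 0 < C := pos_of_mul_pos_left ((pow_pos (hd 0) 3).trans_le (hC 0)) (sq_nonneg _)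
  refine ⟨8 * C ^ 3, by positivity, fun m => ?_⟩
  have h1 := betaComplexity_mul_gcd m
  have h2 : (diffSeq (m + 1) : ℝ) ≤ ((∑ i, equalizer m i : ℤ) : ℝ) := by
    exact_mod_cast diffSeq_le_sum_equalizer m
  have h3 := hC m
  have h4 : (2 : ℝ) ^ (m + 1) ≤ 8 * (diffSeq (m + 1) : ℝ) ^ 3 := by
    exact_mod_cast two_pow_le_diffSeq m
  have hs := hs m
  rw [← h1] at h2
  set s := (diffSeq (m + 1) : ℝ)
  set F := (betaComplexity (m + 1) : ℝ)
  have hF : 0 ≤ F := Nat.cast_nonneg _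
  have h5 : s ≤ C * F ^ 3 := by
    have h6 : s ^ 3 ≤ F ^ 3 * (C * s ^ 2) :=
      calc s ^ 3 ≤ (F * Int.gcd (bSeq (m + 1)) (bSeq (m + 2))) ^ 3 :=
            pow_le_pow_left₀ hs.le h2 3
        _ ≤ F ^ 3 * (C * s ^ 2) := by
            rw [mul_pow]
            exact mul_le_mul_of_nonneg_left h3 (by positivity)
    refine le_of_mul_le_mul_right ?_ (pow_pos hs 2)
    calc s * s ^ 2 = s ^ 3 := by ring
      _ ≤ F ^ 3 * (C * s ^ 2) := h6
      _ = C * F ^ 3 * s ^ 2 := by ring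
  calc (2 : ℝ) ^ (m + 1) ≤ 8 * s ^ 3 := h4
    _ ≤ 8 * (C * F ^ 3) ^ 3 := by
        have := pow_le_pow_left₀ hs.le h5 3
        linarith
    _ = 8 * C ^ 3 * F ^ 9 := by ring

theorem betaComplexity_pos (m : ℕ) : 0 < betaComplexity (m + 1) := by
  obtain ⟨C, hC, h⟩ := exists_le_betaComplexity
  refine Nat.pos_of_ne_zero fun h0 => ?_
  have := h m
  rw [h0] at this
  have h2 : (0 : ℝ) < 2 ^ (m + 1) := by positivity
  simp at this
  linarith

theorem logb_betaComplexity_isTheta :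
    (fun n => Real.logb 2 (betaComplexity n)) =Θ[atTop] fun n : ℕ => (n : ℝ) := by
  obtain ⟨C, hC, h⟩ := exists_le_betaComplexity
  constructor
  · refine IsBigO.of_bound 2 ?_
    filter_upwards [eventually_ge_atTop 1] with n hn
    obtain ⟨m, rfl⟩ : ∃ m, n = m + 1 := ⟨n - 1, by omega⟩
    have hpos : (1 : ℝ) ≤ betaComplexity (m + 1) := by exact_mod_cast betaComplexity_pos m
    rw [Real.norm_of_nonneg (Real.logb_nonneg one_lt_two hpos),
      Real.norm_of_nonneg (Nat.cast_nonneg _)]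
    have h1 := Real.logb_le_logb_of_le one_lt_two (by linarith) (betaComplexity_le m)
    have h2 : Real.logb 2 ((4 : ℝ) ^ (m + 1)) = 2 * ((m + 1 : ℕ) : ℝ) := by
      rw [show (4 : ℝ) = 2 ^ 2 by norm_num, ← pow_mul, Real.logb_pow, Real.logb_self_eq_one one_lt_two]
      push_cast
      ring
    linarith
  · refine IsBigO.of_bound 18 ?_
    filter_upwards [eventually_ge_atTop 1, eventually_ge_atTop ⌈2 * Real.logb 2 C⌉₊] with n hn hn2
    obtain ⟨m, rfl⟩ : ∃ m, n = m + 1 := ⟨n - 1, by omega⟩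
    have hpos : (1 : ℝ) ≤ betaComplexity (m + 1) := by exact_mod_cast betaComplexity_pos m
    rw [Real.norm_of_nonneg (Real.logb_nonneg one_lt_two hpos),
      Real.norm_of_nonneg (Nat.cast_nonneg _)]
    have h1 := Real.logb_le_logb_of_le one_lt_two (by positivity) (h m)
    rw [Real.logb_mul hC.ne' (by positivity), Real.logb_pow, Real.logb_pow,
      Real.logb_self_eq_one one_lt_two] at h1
    have h2 : 2 * Real.logb 2 C ≤ ((m + 1 : ℕ) : ℝ) := Nat.ceil_le.1 hn2
    push_cast at h1 h2 ⊢
    linarith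

/-! ### The exponent and the main theorem -/

/-- The exponent of the complexity. -/
noncomputable def complexityExponent (n : ℕ) : ℝ :=
  Real.logb 2 (if n = 3 ∨ n = 6 ∨ n = 7 then n else betaComplexity n)

theorem complexityExponent_isTheta :
    complexityExponent =Θ[atTop] fun n : ℕ => (n : ℝ) := by
  refine IsTheta.trans (EventuallyEq.isTheta ?_) logb_betaComplexity_isTheta
  filter_upwards [eventually_ge_atTop 8] with n hn
  rw [complexityExponent, if_neg (by omega)]

theorem natCast_eq_two_rpow_logb {k : ℕ} (hk : 0 < k) :
    (((k : ℕ∞) : ℕ∞) : ℝ≥0∞) = 2 ^ Real.logb 2 k := by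
  have hk' : (0 : ℝ) < k := by exact_mod_cast hk
  have h1 : (2 : ℝ≥0∞) = ENNReal.ofReal 2 := by simp
  rw [h1, ENNReal.ofReal_rpow_of_pos two_pos, Real.rpow_logb two_pos (by norm_num) hk']
  simp

theorem two_rpow_complexityExponent_of_exceptional {m : ℕ} (h : m = 2 ∨ m = 5 ∨ m = 6) :
    (2 : ℝ≥0∞) ^ complexityExponent (m + 1) = (((m + 1 : ℕ) : ℕ∞) : ℝ≥0∞) := by
  rw [complexityExponent, if_pos (by omega), natCast_eq_two_rpow_logb m.succ_pos]

theorem two_rpow_complexityExponent {m : ℕ} (h : ¬ (m = 2 ∨ m = 5 ∨ m = 6)) :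
    (2 : ℝ≥0∞) ^ complexityExponent (m + 1) = ((betaComplexity (m + 1) : ℕ∞) : ℝ≥0∞) := by
  rw [complexityExponent, if_neg (by omega), natCast_eq_two_rpow_logb (betaComplexity_pos m)]

end RandomGames

theorem theorem3 :
    ∃ g : ℕ → ℝ, (g =Θ[atTop] fun n : ℕ => (n : ℝ)) ∧
      (∀ n : ℕ, 1 ≤ n → ∃ A B : Matrix (Fin n) (Fin n) ℤ,
        RandomGames.IsBinary A ∧ RandomGames.IsBinary B ∧
        (RandomGames.minComplexity₁ A B : ℝ≥0∞) = 2 ^ g n ∧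
        RandomGames.minComplexity₂ A B = (n : ℕ∞)) ∧
      (∀ n : ℕ, 1 ≤ n → ∃ A B : Matrix (Fin n) (Fin n) ℤ,
        RandomGames.IsBinary A ∧ RandomGames.IsBinary B ∧
        A + B = RandomGames.ones n ∧
        (RandomGames.minComplexity₁ A B : ℝ≥0∞) = 2 ^ g n ∧
        (RandomGames.minComplexity₂ A B : ℝ≥0∞) = 2 ^ g n) ∧
      (∀ n : ℕ, 1 ≤ n → n ∉ ({3, 6, 7} : Set ℕ) →
        RandomGames.IsBinary (RandomGames.beta n) ∧
        (∃ x y : Fin n → ℝ,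
          RandomGames.nashEquilibria 1 (RandomGames.beta n) = {(x, y)} ∧
          (∀ i, 0 < x i) ∧ (∀ j, 0 < y j) ∧
          0 < Int.gcd (RandomGames.bSeq n) (RandomGames.bSeq (n + 1)) ∧
          Int.gcd (RandomGames.bSeq n) (RandomGames.bSeq (n + 1)) ∣
            (RandomGames.cofactorSum (RandomGames.beta n)).natAbs ∧
          RandomGames.complexity x =
            (((RandomGames.cofactorSum (RandomGames.beta n)).natAbs /
              Int.gcd (RandomGames.bSeq n) (RandomGames.bSeq (n + 1)) : ℕ) : ℕ∞) ∧
          RandomGames.complexity y = (n : ℕ∞)) ∧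
        (RandomGames.minComplexity₁ 1 (RandomGames.beta n) : ℝ≥0∞) = 2 ^ g n ∧
        RandomGames.minComplexity₂ 1 (RandomGames.beta n) = (n : ℕ∞) ∧
        (RandomGames.minComplexity₁ (RandomGames.ones n - RandomGames.beta n)
          (RandomGames.beta n) : ℝ≥0∞) = 2 ^ g n ∧
        (RandomGames.minComplexity₂ (RandomGames.ones n - RandomGames.beta n)
          (RandomGames.beta n) : ℝ≥0∞) = 2 ^ g n) := by
  refine ⟨RandomGames.complexityExponent, RandomGames.complexityExponent_isTheta, ?_, ?_, ?_⟩
  · intro n hn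
    obtain ⟨m, rfl⟩ : ∃ m, n = m + 1 := ⟨n - 1, by omega⟩
    by_cases h : m = 2 ∨ m = 5 ∨ m = 6
    · have hNE := RandomGames.nashEquilibria_one_cyclicMatrix m
      refine ⟨1, RandomGames.cyclicMatrix m, RandomGames.isBinary_one _,
        RandomGames.isBinary_cyclicMatrix m, ?_, ?_⟩
      · rw [RandomGames.minComplexity₁_of_singleton hNE, RandomGames.complexity_uniform,
          RandomGames.two_rpow_complexityExponent_of_exceptional h]
      · rw [RandomGames.minComplexity₂_of_singleton hNE, RandomGames.complexity_uniform]
    · obtain ⟨x, y, hNE, -, -, hx, -⟩ := RandomGames.exists_equilibria_beta (m := m)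
        (by omega) (by omega) (by omega)
      refine ⟨1, RandomGames.beta (m + 1), RandomGames.isBinary_one _,
        RandomGames.isBinary_beta _, ?_, ?_⟩
      · rw [RandomGames.minComplexity₁_of_singleton hNE, hx,
          RandomGames.two_rpow_complexityExponent h]
      · rw [RandomGames.minComplexity₂_of_singleton hNE, RandomGames.complexity_uniform]
  · intro n hn
    obtain ⟨m, rfl⟩ : ∃ m, n = m + 1 := ⟨n - 1, by omega⟩
    by_cases h : m = 2 ∨ m = 5 ∨ m = 6
    · have hNE := RandomGames.nashEquilibria_ones_sub_cyclicMatrix m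
      refine ⟨_, RandomGames.cyclicMatrix m, (RandomGames.isBinary_cyclicMatrix m).ones_sub,
        RandomGames.isBinary_cyclicMatrix m, sub_add_cancel _ _, ?_, ?_⟩
      · rw [RandomGames.minComplexity₁_of_singleton hNE, RandomGames.complexity_uniform,
          RandomGames.two_rpow_complexityExponent_of_exceptional h]
      · rw [RandomGames.minComplexity₂_of_singleton hNE, RandomGames.complexity_uniform,
          RandomGames.two_rpow_complexityExponent_of_exceptional h]
    · obtain ⟨x, y, -, hNE, -, hx, hy⟩ := RandomGames.exists_equilibria_beta (m := m)
        (by omega) (by omega) (by omega)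
      refine ⟨_, RandomGames.beta (m + 1), (RandomGames.isBinary_beta _).ones_sub,
        RandomGames.isBinary_beta _, sub_add_cancel _ _, ?_, ?_⟩
      · rw [RandomGames.minComplexity₁_of_singleton hNE, hx,
          RandomGames.two_rpow_complexityExponent h]
      · rw [RandomGames.minComplexity₂_of_singleton hNE, hy,
          RandomGames.two_rpow_complexityExponent h]
  · intro n hn hne
    obtain ⟨m, rfl⟩ : ∃ m, n = m + 1 := ⟨n - 1, by omega⟩
    have h : ¬ (m = 2 ∨ m = 5 ∨ m = 6) := by
      rintro (rfl | rfl | rfl) <;> simp at hne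
    obtain ⟨x, y, hNE, hNE', hpos, hx, hy⟩ := RandomGames.exists_equilibria_beta (m := m)
      (by omega) (by omega) (by omega)
    refine ⟨RandomGames.isBinary_beta _, ⟨x, _, hNE, hpos, fun _ => by positivity,
      RandomGames.gcd_bSeq_pos m, RandomGames.gcd_bSeq_dvd_cofactorSum m, hx,
      RandomGames.complexity_uniform m⟩, ?_, ?_, ?_, ?_⟩
    · rw [RandomGames.minComplexity₁_of_singleton hNE, hx,
        RandomGames.two_rpow_complexityExponent h]
    · rw [RandomGames.minComplexity₂_of_singleton hNE, RandomGames.complexity_uniform]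
    · rw [RandomGames.minComplexity₁_of_singleton hNE', hx,
        RandomGames.two_rpow_complexityExponent h]
    · rw [RandomGames.minComplexity₂_of_singleton hNE', hy,
        RandomGames.two_rpow_complexityExponent h]
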